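/- Let $ID$ be the class of infinitely divisible probability measures on $\mathbb{R}$ (those $\mu$ which for every $n\ge 1$ are an $n$-fold convolution power of a probability measure), and for $k\ge 0$ let $ID_{\log^{k+1}}$ be the set of $\mu\in ID$ with $\int_{\mathbb{R}}\log^{k+1}(1+|x|)\,\mu(dx)<\infty$. For $k\ge 0$ let $(L_k,\ast)$ (Urbanik's class of $k$-times selfdecomposable measures) be the class of laws of the random integrals $$\int_{(0,\infty)}e^{-t}\,dY(r_k(t)),\qquad r_k(t)=\frac{t^{k+1}}{(k+1)!},$$ where $Y$ is a càdlàg real Lévy process such that the law of $Y(1)$ is in $ID_{\log^{k+1}}$; the integral over $(0,T]$ is defined pathwise by integration by parts and the integral over $(0,\infty)$ is its limit in probability as $T\to\infty$. For $\nu\in ID$ with characteristic function $\phi_\nu$, the Voiculescu transform (on the imaginary axis) of the free-probability counterpart $\tilde\nu$ of $\nu$ is $$V_{\tilde\nu}(it)=it^2\int_0^\infty \log\phi_\nu(-u)\,e^{-tu}\,du,\qquad t>0,$$ where $\log\phi_\nu$ is the continuous logarithm vanishing at $0$. For $k\ge 0$ let $(L_k,\boxplus)$ be the set of functions $t\mapsto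 V_{\tilde\nu}(it)$, $t>0$, with $\nu\in(L_k,\ast)$. Let $(L_{-1},\boxplus)=(ID,\boxplus)$ be the set of free-infinitely divisible Voiculescu transforms, that is, of the functions $$t\mapsto V(it)=a+\int_{\mathbb{R}}\frac{1+itx}{it-x}\,m(dx),\qquad t>0,$$ with $a\in\mathbb{R}$ and $m$ a finite Borel measure on $\mathbb{R}$. For a differentiable function $f:(0,\infty)\to\mathbb{C}$ put $Df(t)=f(t)-t f'(t)$. Then for every integer $k\ge 0$ every $f\in(L_k,\boxplus)$ is differentiable, and $D$ maps $(L_k,\boxplus)$ into $(L_{k-1},\boxplus)$. Hence on $(L_k,\boxplus)$ the iterate $D^{k+1}$ is defined (all the derivatives involved exist) and $D^{k+1}$ maps $(L_k,\boxplus)$ into $(ID,\boxplus)$. -/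

import Mathlib

open MeasureTheory ProbabilityTheory Filter Topology Set
open scoped NNReal Nat

noncomputable section

/-- `μ` is an infinitely divisible probability measure on `ℝ`: for every `n ≥ 1` it is the `n`-fold
convolution power of some probability measure. This is the class `(ID, ∗)`. -/
def IsInfDivisible (μ : Measure ℝ) : Prop :=
  IsProbabilityMeasure μ ∧ ∀ n : ℕ, 1 ≤ n → ∃ ν : Measure ℝ, IsProbabilityMeasure ν ∧
    (fun ρ : Measure ℝ => Measure.conv ρ ν)^[n] (Measure.dirac 0) = μ

/-- The class `ID_{log^{k+1}}`: infinitely divisible laws `μ` with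
`∫ log^{k+1}(1 + |x|) μ(dx) < ∞`. -/
def IDLog (k : ℕ) : Set (Measure ℝ) :=
  {μ | IsInfDivisible μ ∧ Integrable (fun x : ℝ => Real.log (1 + |x|) ^ (k + 1)) μ}

/-- Real-valued Lévy processes: `Y 0 = 0` almost surely, stationary and independent increments,
right-continuous paths with left limits. -/
structure IsLevyProcess {Ω : Type} [MeasurableSpace Ω] (Y : ℝ≥0 → Ω → ℝ) (P : Measure Ω) :
    Prop where
  measurable : ∀ t, Measurable (Y t)
  zero : ∀ᵐ ω ∂P, Y 0 ω = 0
  indep : HasIndepIncrements Y P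
  stationary : ∀ s t : ℝ≥0, P.map (fun ω => Y (s + t) ω - Y s ω) = P.map (Y t)
  right_cont : ∀ ω t, ContinuousWithinAt (fun u => Y u ω) (Ici t) t
  left_lim : ∀ ω t, ∃ l : ℝ, Tendsto (fun u => Y u ω) (𝓝[<] t) (𝓝 l)

/-- The time change `r_k(t) = t^{k+1} / (k+1)!`, for `t ≥ 0`. -/
def timeChange (k : ℕ) (t : ℝ) : ℝ≥0 := Real.toNNReal (t ^ (k + 1) / ((k + 1)! : ℝ))

/-- The pathwise integral `∫_{(0,T]} e^{-t} dY(r_k(t))`, defined by integration by parts. -/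
def expIntegral {Ω : Type} (k : ℕ) (Y : ℝ≥0 → Ω → ℝ) (T : ℝ) (ω : Ω) : ℝ :=
  Real.exp (-T) * Y (timeChange k T) ω - Y (timeChange k 0) ω
    + ∫ t in (0 : ℝ)..T, Y (timeChange k t) ω * Real.exp (-t)

/-- `ν` is the law of the improper random integral `∫_{(0,∞)} e^{-t} dY(r_k(t))`, the limit in
probability of the integrals over `(0,T]`, where `Y` is a Lévy process and `Y(1)` has law `μ`. -/
def IsRandomIntegralLaw (k : ℕ) (μ ν : Measure ℝ) : Prop :=
  ∃ (Ω : Type) (_ : MeasurableSpace Ω) (P : Measure Ω) (Y : ℝ≥0 → Ω → ℝ) (Z : Ω → ℝ),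
    IsProbabilityMeasure P ∧ IsLevyProcess Y P ∧ HasLaw (Y 1) μ P ∧
    TendstoInMeasure P (fun T : ℝ => expIntegral k Y T) atTop Z ∧ HasLaw Z ν P

/-- Urbanik's class `(L_k, ∗)` of `k`-times selfdecomposable laws: the laws of
`∫_{(0,∞)} e^{-t} dY(r_k(t))` with the law of `Y(1)` in `ID_{log^{k+1}}`. -/
def UrbanikClass (k : ℕ) : Set (Measure ℝ) :=
  {ν | ∃ μ ∈ IDLog k, IsRandomIntegralLaw k μ ν}

/-- `V`, read as `t ↦ V(it)` on `(0,∞)`, is the Voiculescu transform of the free-probability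
counterpart of `μ`: `V(it) = i t² ∫_0^∞ log φ_μ(-u) e^{-tu} du` for `t > 0`, where `ψ = log φ_μ` is
the continuous logarithm, vanishing at `0`, of the characteristic function `φ_μ`. -/
def IsCounterpartTransform (μ : Measure ℝ) (V : ℝ → ℂ) : Prop :=
  ∃ ψ : ℝ → ℂ, Continuous ψ ∧ ψ 0 = 0 ∧ (∀ u : ℝ, charFun μ u = Complex.exp (ψ u)) ∧
    ∀ t : ℝ, 0 < t →
      IntegrableOn (fun u : ℝ => ψ (-u) * (Real.exp (-(t * u)) : ℂ)) (Ioi 0) ∧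
      V t = Complex.I * (t : ℂ) ^ 2 * ∫ u in Ioi (0 : ℝ), ψ (-u) * (Real.exp (-(t * u)) : ℂ)

/-- `(ID, ⊞)`: the transforms `t ↦ V(it)`, `t > 0`, with `V(it) = a + ∫ (1 + itx)/(it - x) m(dx)`
for some real `a` and some finite Borel measure `m` on `ℝ`. -/
def FreeID : Set (ℝ → ℂ) :=
  {V | ∃ (a : ℝ) (m : Measure ℝ), IsFiniteMeasure m ∧ ∀ t : ℝ, 0 < t →
    V t = (a : ℂ) + ∫ x : ℝ, (1 + Complex.I * t * x) / (Complex.I * t - x) ∂m}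

/-- `(L_k, ⊞)`, `k ≥ 0`: the transforms of the free-probability counterparts of the laws in
`(L_k, ∗)`. -/
def FreeUrbanik (k : ℕ) : Set (ℝ → ℂ) :=
  {V | ∃ ν ∈ UrbanikClass k, IsCounterpartTransform ν V}

/-- `(L_{k-1}, ⊞)` for `k ≥ 0`, with `(L_{-1}, ⊞) = (ID, ⊞)`. -/
def FreeUrbanikPred : ℕ → Set (ℝ → ℂ)
  | 0 => FreeID
  | k + 1 => FreeUrbanik k

/-- The operator `(D f)(t) = f(t) - t f'(t)`. -/
def opD (f : ℝ → ℂ) (t : ℝ) : ℂ := f t - (t : ℂ) * deriv f t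

end

/-! Let `ψ` be the Lévy exponent of `Y`, so that `Y(t)` has characteristic function `exp(tψ)`. The
random integral with clock `r_k` then has the exponent `ψ_k(u) = ∫_0^∞ ψ(e^{-t}u) t^k/k! dt`
(`charFun_expIntegral_sub`, `charFun_of_tendstoInMeasure`). The log moment of `Y(1)` makes this
integral converge, with a bound locally uniform in `u` (`exists_norm_le_decayWeight`,
`integrableOn_decayWeight_mul_pow`).

In the variable `x = log t`, dilations of `u` become translations. With `H_g(x) = e^x ∫_0^∞ g(-u)
exp(-e^x u) du`, Fubini gives `H_{ψ_k}(x) = ∫_0^∞ H_ψ(x+r) r^k/k! dr`, hence `H_{ψ_k}' =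
-H_{ψ_{k-1}}`, where `ψ_{-1} = ψ`. Since `V(it) = i t H_{ψ_k}(log t)` and `D(t h(log t)) = -t h'(log
t)`, the operator `D` replaces `ψ_k` by `ψ_{k-1}` (`hasDerivAt_and_opD_eq`).

It remains to recognise the result. For `k ≥ 1`, `ψ_{k-1}` is the exponent of the integral of the
same process `Y` with clock `r_{k-1}`, whose existence is proved from the decay of `ψ`
(`exists_tendstoInMeasure`). For `k = 0` the transform of `ψ` itself must be free-infinitely
divisible (`IsLevyExponent.mem_freeID`): `ψ` is the limit of the compound Poisson exponents
`N(φ^{1/N} - 1)`, whose transforms have the required form explicitly, and tightness of the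
representing measures lets that form pass to the limit. -/

/-! ### Continuous logarithms and the exponent of a Lévy process. -/

/-- A continuous logarithm on `ℝ` is determined by its value at `0`. -/
lemma eq_of_exp_comp_eq {f g : ℝ → ℂ} (hf : Continuous f) (hg : Continuous g)
    (h0 : f 0 = g 0) (h : ∀ u, Complex.exp (f u) = Complex.exp (g u)) : f = g := by
  refine Complex.isCoveringMap_exp.eq_of_comp_eq hf hg ?_ 0 h0
  ext u
  simpa using h u

lemma exists_continuous_log {g : ℝ → ℂ} (hg : Continuous g) (hg0 : g 0 = 1)
    (hne : ∀ u, g u ≠ 0) :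
    ∃ ψ : ℝ → ℂ, Continuous ψ ∧ ψ 0 = 0 ∧ ∀ u, g u = Complex.exp (ψ u) := by
  obtain ⟨F, ⟨h0, hF⟩, -⟩ := Complex.isCoveringMapOn_exp.existsUnique_continuousMap_lifts
    ⟨g, hg⟩ (a₀ := 0) (e₀ := 0) (by simp [hg0]) (fun u => by simpa using hne u)
  exact ⟨F, F.continuous, h0, fun u => (congrFun hF u).symm⟩

namespace IsLevyProcess

variable {Ω : Type} [MeasurableSpace Ω] {P : Measure Ω} {Y : ℝ≥0 → Ω → ℝ}

lemma map_increment (h : IsLevyProcess Y P) {s t : ℝ≥0} (hst : s ≤ t) :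
    P.map (fun ω => Y t ω - Y s ω) = P.map (Y (t - s)) := by
  have := h.stationary s (t - s)
  rwa [add_tsub_cancel_of_le hst] at this

lemma charFun_add [IsProbabilityMeasure P] (h : IsLevyProcess Y P) (s t : ℝ≥0) (u : ℝ) :
    charFun (P.map (Y (s + t))) u = charFun (P.map (Y s)) u * charFun (P.map (Y t)) u := by
  have hind := h.indep.indepFun_eval_sub zero_le (le_self_add (a := s) (b := t)) h.zero
  have hs := h.measurable
  have := congrFun (hind.charFun_map_add_eq_mul (hs s).aemeasurable
    ((hs (s + t)).sub (hs s)).aemeasurable) u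
  rw [show Y s + (Y (s + t) - Y s) = Y (s + t) by abel] at this
  rw [this, Pi.mul_apply, show P.map (Y (s + t) - Y s) = P.map (Y t) from h.stationary s t]

lemma charFun_map_zero [IsProbabilityMeasure P] (h : IsLevyProcess Y P) (u : ℝ) :
    charFun (P.map (Y 0)) u = 1 := by
  rw [charFun_apply_real, integral_map (h.measurable 0).aemeasurable (by fun_prop)]
  rw [integral_congr_ae (g := fun _ => (1 : ℂ))]
  · simp
  · filter_upwards [h.zero] with ω hω
    simp [hω]

lemma charFun_nsmul [IsProbabilityMeasure P] (h : IsLevyProcess Y P) (n : ℕ) (t : ℝ≥0) (u : ℝ) :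
    charFun (P.map (Y (n * t))) u = charFun (P.map (Y t)) u ^ n := by
  induction n with
  | zero => simp [h.charFun_map_zero]
  | succ n ih => rw [Nat.cast_succ, add_mul, one_mul, h.charFun_add, ih, pow_succ]

/-- Paths are only right-continuous, so times are approached from above; bounded convergence does
the rest. -/
lemma tendsto_charFun [IsProbabilityMeasure P] (h : IsLevyProcess Y P) {s : ℕ → ℝ≥0} {t : ℝ≥0}
    (hs : Tendsto s atTop (𝓝 t)) (hst : ∀ n, t ≤ s n) (u : ℝ) :
    Tendsto (fun n => charFun (P.map (Y (s n))) u) atTop (𝓝 (charFun (P.map (Y t)) u)) := by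
  have hm := h.measurable
  have e : ∀ r, charFun (P.map (Y r)) u = ∫ ω, Complex.exp (u * Y r ω * Complex.I) ∂P := by
    intro r
    rw [charFun_apply_real, integral_map (h.measurable r).aemeasurable (by fun_prop)]
  simp only [e]
  refine tendsto_integral_of_dominated_convergence (fun _ => 1) (fun n => ?_)
    (integrable_const _) (fun n => ?_) ?_
  · have := hm (s n)
    exact Measurable.aestronglyMeasurable (by fun_prop)
  · refine Eventually.of_forall fun ω => ?_
    rw [← Complex.ofReal_mul, Complex.norm_exp_ofReal_mul_I]
  · refine Eventually.of_forall fun ω => ?_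
    have h1 : Tendsto (fun n => Y (s n) ω) atTop (𝓝 (Y t ω)) :=
      (h.right_cont ω t).tendsto.comp (tendsto_nhdsWithin_iff.2 ⟨hs, Eventually.of_forall hst⟩)
    have h2 : Continuous fun y : ℝ => Complex.exp (u * y * Complex.I) := by fun_prop
    exact (h2.tendsto _).comp h1

/-- The Lévy exponent: `E exp(iuY_t) = exp(tψ(u))` with `ψ` continuous and `ψ(0) = 0`. -/
lemma exists_exponent [IsProbabilityMeasure P] (h : IsLevyProcess Y P) :
    ∃ ψ : ℝ → ℂ, Continuous ψ ∧ ψ 0 = 0 ∧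
      ∀ (t : ℝ≥0) (u : ℝ), charFun (P.map (Y t)) u = Complex.exp (t * ψ u) := by
  have hprob : ∀ t, IsProbabilityMeasure (P.map (Y t)) := fun t =>
    Measure.isProbabilityMeasure_map (h.measurable t).aemeasurable
  have hroot : ∀ (n : ℕ) (u : ℝ), charFun (P.map (Y (1 / (n + 1 : ℕ)))) u ^ (n + 1)
      = charFun (P.map (Y 1)) u := by
    intro n u
    rw [← h.charFun_nsmul, mul_one_div_cancel (by positivity)]
  -- A zero of the characteristic function at time 1 would be a zero at every time `1/(n+1)`,
  -- whereas those values tend to 1.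
  have hne : ∀ u, charFun (P.map (Y 1)) u ≠ 0 := by
    intro u
    have h0 := h.tendsto_charFun (s := fun n : ℕ => 1 / ((n + 1 : ℕ) : ℝ≥0)) (t := 0)
      (by simpa using tendsto_one_div_add_atTop_nhds_zero_nat (𝕜 := ℝ≥0)) (fun n => zero_le) u
    rw [h.charFun_map_zero] at h0
    obtain ⟨n, hn⟩ := (h0.eventually_ne one_ne_zero).exists
    rw [← hroot n u]
    exact pow_ne_zero _ hn
  obtain ⟨ψ, hψc, hψ0, hψ⟩ := exists_continuous_log (g := charFun (P.map (Y 1)))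
    continuous_charFun (by simp) hne
  refine ⟨ψ, hψc, hψ0, ?_⟩
  have hn : ∀ (n : ℕ) (u : ℝ), charFun (P.map (Y (1 / (n + 1 : ℕ)))) u
      = Complex.exp (ψ u / (n + 1 : ℕ)) := by
    intro n
    obtain ⟨χ, hχc, hχ0, hχ⟩ := exists_continuous_log
      (g := charFun (P.map (Y (1 / (n + 1 : ℕ))))) continuous_charFun (by simp) (fun u hu => by
        apply hne u
        rw [← hroot n u, hu]
        simp)
    -- Both sides are continuous logarithms of the same function vanishing at 0; this selects the
    -- correct root.
    have : (fun u => ((n + 1 : ℕ) : ℂ) * χ u) = ψ := by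
      refine eq_of_exp_comp_eq (by fun_prop) hψc (by simp [hχ0, hψ0]) fun u => ?_
      rw [Complex.exp_nat_mul, ← hχ, hroot, hψ]
    intro u
    have hN : ((n + 1 : ℕ) : ℂ) ≠ 0 := Nat.cast_ne_zero.2 n.succ_ne_zero
    rw [hχ, ← this, mul_div_cancel_left₀ _ hN]
  intro t u
  -- Rational times `⌈tN⌉/N`, with `N = n + 1`, approach `t` from above, as right continuity
  -- requires.
  have hlim : Tendsto (fun n : ℕ => ((⌈t * ((n + 1 : ℕ) : ℝ≥0)⌉₊ : ℝ≥0) / ((n + 1 : ℕ) : ℝ≥0)))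
      atTop (𝓝 t) := by
    rw [← NNReal.tendsto_coe]
    refine ((tendsto_nat_ceil_mul_div_atTop (R := ℝ) t.2).comp
      (tendsto_natCast_atTop_atTop.comp (tendsto_add_atTop_nat 1))).congr fun n => ?_
    have : ⌈(t : ℝ) * ((n + 1 : ℕ) : ℝ)⌉₊ = ⌈t * ((n + 1 : ℕ) : ℝ≥0)⌉₊ :=
      Nonneg.nat_ceil_coe (t * ((n + 1 : ℕ) : ℝ≥0))
    simp only [Function.comp_apply, ← this, NNReal.coe_div, NNReal.coe_natCast]
    rfl
  have h1 := h.tendsto_charFun hlim (fun n => by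
    rw [le_div_iff₀ (by positivity)]
    exact Nat.le_ceil _) u
  refine tendsto_nhds_unique h1 ?_
  have h2 : ∀ n : ℕ, charFun (P.map (Y ((⌈t * ((n + 1 : ℕ) : ℝ≥0)⌉₊ : ℝ≥0) / ((n + 1 : ℕ) : ℝ≥0)))) u
      = Complex.exp ((((⌈t * ((n + 1 : ℕ) : ℝ≥0)⌉₊ : ℝ≥0) / ((n + 1 : ℕ) : ℝ≥0) : ℝ≥0) : ℂ) * ψ u) := by
    intro n
    rw [div_eq_mul_one_div, h.charFun_nsmul, hn, ← Complex.exp_nat_mul]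
    congr 1
    push_cast
    ring
  simp only [h2]
  have h3 : Continuous fun r : ℝ≥0 => Complex.exp ((r : ℂ) * ψ u) := by fun_prop
  exact (h3.tendsto t).comp hlim

end IsLevyProcess

/-! ### Quadratic growth of Lévy exponents. -/

/-- Mean value inequality on the convex left half-plane, where the derivative of `exp` has norm at
most 1. -/
lemma norm_exp_sub_one_le_of_re_nonpos {z : ℂ} (hz : z.re ≤ 0) :
    ‖Complex.exp z - 1‖ ≤ ‖z‖ := by
  have h := (convex_halfSpace_re_le (0 : ℝ)).norm_image_sub_le_of_norm_hasDerivWithin_le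
    (f := Complex.exp) (f' := Complex.exp) (C := 1) (x := 0) (y := z)
    (fun x _ => (Complex.hasDerivAt_exp x).hasDerivWithinAt)
    (fun x hx => by
      rw [Complex.norm_exp, Real.exp_le_one_iff]
      exact hx) (by simp) hz
  simpa using h

/-- This is the derivative of `s ↦ exp(sz)` at 0. It carries estimates for `φ^{1/N} - 1` over to the
exponent. -/
lemma tendsto_mul_exp_div_sub_one (z : ℂ) :
    Tendsto (fun n : ℕ => ((n + 1 : ℕ) : ℂ) * (Complex.exp (z / (n + 1 : ℕ)) - 1)) atTop (𝓝 z) := by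
  have hd : HasDerivAt (fun s : ℂ => Complex.exp (s * z)) z 0 := by
    have := ((hasDerivAt_id (0 : ℂ)).mul_const z).cexp
    simpa using this
  have h1 : Tendsto (fun n : ℕ => (((n + 1 : ℕ) : ℂ))⁻¹) atTop (𝓝[≠] 0) := by
    refine tendsto_nhdsWithin_iff.2 ⟨?_, Eventually.of_forall fun n => ?_⟩
    · simpa using tendsto_one_div_add_atTop_nhds_zero_nat (𝕜 := ℂ)
    · simpa using Nat.cast_add_one_ne_zero (R := ℂ) n
  refine (hd.tendsto_slope_zero.comp h1).congr fun n => ?_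
  simp [div_eq_inv_mul]

/-- With `e = exp(iux)`, one has `e² - 1 = 2(e - 1) + (e - 1)²` and `|e - 1|² = 2(1 - Re e)`. After
integration the square contributes at most `2(1 - Re φ(u)) ≤ 2|φ(u) - 1|`. -/
lemma norm_charFun_two_mul_sub_one_le (ν : Measure ℝ) [IsProbabilityMeasure ν] (u : ℝ) :
    ‖charFun ν (2 * u) - 1‖ ≤ 4 * ‖charFun ν u - 1‖ := by
  have hi : ∀ v : ℝ, Integrable (fun x : ℝ => Complex.exp (v * x * Complex.I)) ν := by
    intro v
    refine Integrable.of_bound (C := 1) (by fun_prop) (Eventually.of_forall fun x => ?_)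
    rw [← Complex.ofReal_mul, Complex.norm_exp_ofReal_mul_I]
  have hsq : charFun ν (2 * u) - 1 - 2 * (charFun ν u - 1)
      = ∫ x : ℝ, (Complex.exp (u * x * Complex.I) - 1) ^ 2 ∂ν := by
    have : ∀ x : ℝ, (Complex.exp (u * x * Complex.I) - 1) ^ 2 =
        Complex.exp ((2 * u : ℝ) * x * Complex.I) - 2 * Complex.exp (u * x * Complex.I) + 1 := by
      intro x
      rw [show (((2 * u : ℝ) : ℂ) * x * Complex.I) = (2 : ℕ) * (u * x * Complex.I) by
        push_cast; ring, Complex.exp_nat_mul]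
      ring
    simp only [this]
    have hi2 : Integrable (fun x : ℝ => Complex.exp ((2 * u : ℝ) * x * Complex.I)
      - 2 * Complex.exp (u * x * Complex.I)) ν := (hi _).sub ((hi u).const_mul 2)
    rw [integral_add hi2 (integrable_const _),
      integral_sub (hi _) ((hi u).const_mul 2), integral_const_mul, charFun_apply_real,
      charFun_apply_real]
    simp
    ring
  have hire : Integrable (fun x : ℝ => (Complex.exp (u * x * Complex.I)).re) ν := (hi u).re
  have hre : ∫ x : ℝ, 2 * (1 - (Complex.exp (u * x * Complex.I)).re) ∂ν
      = 2 * (1 - (charFun ν u).re) := by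
    rw [integral_const_mul, integral_sub (integrable_const _) hire, charFun_apply_real]
    have := integral_re (hi u)
    simp only [RCLike.re_to_complex] at this
    simp [this]
  have hle : ‖∫ x : ℝ, (Complex.exp (u * x * Complex.I) - 1) ^ 2 ∂ν‖ ≤
      2 * (1 - (charFun ν u).re) := by
    rw [← hre]
    refine norm_integral_le_of_norm_le (((integrable_const 1).sub hire).const_mul 2)
      (Eventually.of_forall fun x => le_of_eq ?_)
    rw [norm_pow, ← Complex.normSq_eq_norm_sq, ← Complex.ofReal_mul, Complex.normSq_apply]
    simp only [Complex.sub_re, Complex.sub_im, Complex.exp_ofReal_mul_I_re,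
      Complex.exp_ofReal_mul_I_im, Complex.one_re, Complex.one_im]
    nlinarith [Real.sin_sq_add_cos_sq (u * x)]
  have h1 : 1 - (charFun ν u).re ≤ ‖charFun ν u - 1‖ := by
    have := (abs_le.1 (Complex.abs_re_le_norm (charFun ν u - 1))).1
    simp at this
    linarith
  calc ‖charFun ν (2 * u) - 1‖
      = ‖(charFun ν (2 * u) - 1 - 2 * (charFun ν u - 1)) + 2 * (charFun ν u - 1)‖ := by ring_nf
    _ ≤ 2 * (1 - (charFun ν u).re) + 2 * ‖charFun ν u - 1‖ := by
        refine (norm_add_le _ _).trans (add_le_add (hsq ▸ hle) ?_)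
        rw [norm_mul]; simp
    _ ≤ _ := by linarith

/-- Continuous logarithms of characteristic functions of infinitely divisible laws. -/
structure IsLevyExponent (ψ : ℝ → ℂ) : Prop where
  continuous : Continuous ψ
  zero : ψ 0 = 0
  root : ∀ n : ℕ, ∃ ν : Measure ℝ, IsProbabilityMeasure ν ∧
    ∀ u, charFun ν u = Complex.exp (ψ u / (n + 1 : ℕ))

namespace IsLevyExponent

variable {ψ : ℝ → ℂ}

lemma re_nonpos (h : IsLevyExponent ψ) (u : ℝ) : (ψ u).re ≤ 0 := by
  obtain ⟨ν, hν, hc⟩ := h.root 0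
  have := norm_charFun_le_one (μ := ν) u
  rw [hc, Complex.norm_exp, Real.exp_le_one_iff] at this
  simpa using this

/-- The doubling inequality for the roots `φ^{1/N}` is multiplied by `N`, and `N → ∞`. -/
lemma norm_two_mul_le (h : IsLevyExponent ψ) (u : ℝ) : ‖ψ (2 * u)‖ ≤ 4 * ‖ψ u‖ := by
  refine le_of_tendsto_of_tendsto' (tendsto_mul_exp_div_sub_one (ψ (2 * u))).norm
    ((tendsto_mul_exp_div_sub_one (ψ u)).norm.const_mul 4) fun n => ?_
  obtain ⟨ν, hν, hc⟩ := h.root n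
  rw [← hc, ← hc, norm_mul, norm_mul, mul_left_comm]
  exact mul_le_mul_of_nonneg_left (norm_charFun_two_mul_sub_one_le ν u) (norm_nonneg _)

lemma exists_norm_le (h : IsLevyExponent ψ) : ∃ C, 0 ≤ C ∧ ∀ u, ‖ψ u‖ ≤ C * (1 + u ^ 2) := by
  obtain ⟨M, hM⟩ := isCompact_Icc.exists_bound_of_continuousOn
    (s := Icc (-1 : ℝ) 1) h.continuous.continuousOn
  have hM0 : 0 ≤ M := (norm_nonneg _).trans (hM 0 (by simp))
  -- Each doubling of the argument costs a factor 4, which is what gives growth of order `u²`.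
  have hpow : ∀ (n : ℕ) (u : ℝ), |u| ≤ 2 ^ n → ‖ψ u‖ ≤ M * 4 ^ n := by
    intro n
    induction n with
    | zero => intro u hu; simpa using hM u (by simpa [abs_le] using hu)
    | succ n ih =>
      intro u hu
      have h1 := ih (u / 2) (by
        rw [abs_div, abs_two, div_le_iff₀ two_pos, ← pow_succ]; exact hu)
      have h2 := h.norm_two_mul_le (u / 2)
      rw [mul_div_cancel₀ u two_ne_zero] at h2
      rw [pow_succ]
      linarith
  refine ⟨4 * M, by positivity, fun u => ?_⟩
  rcases le_or_gt |u| 1 with hu | hu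
  · have := hM u (abs_le.1 hu)
    nlinarith [sq_nonneg u, mul_nonneg hM0 (sq_nonneg u)]
  · obtain ⟨n, h1, h2⟩ := exists_nat_pow_near hu.le one_lt_two
    have h3 := hpow (n + 1) u h2.le
    have h4 : (4 : ℝ) ^ n ≤ u ^ 2 := by
      rw [← sq_abs, show (4 : ℝ) = 2 ^ 2 by norm_num, ← pow_mul, mul_comm, pow_mul]
      gcongr
    rw [pow_succ] at h3
    nlinarith [mul_le_mul_of_nonneg_left h4 hM0]

end IsLevyExponent

/-! ### Decay of the exponent at 0 from the log moment. -/

/-- Majorant of the decay of `ψ (e^{-t} u)` as `t → ∞`. -/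
noncomputable def decayWeight (μ : Measure ℝ) (t : ℝ) : ℝ :=
  μ.real {x | t ≤ 2 * Real.log (1 + |x|)} + Real.exp (-(t / 2))

lemma decayWeight_pos (μ : Measure ℝ) (t : ℝ) : 0 < decayWeight μ t :=
  add_pos_of_nonneg_of_pos measureReal_nonneg (Real.exp_pos _)

lemma log_one_add_abs_nonneg (x : ℝ) : 0 ≤ Real.log (1 + |x|) :=
  Real.log_nonneg (by linarith [abs_nonneg x])

lemma integrable_log_pow {μ : Measure ℝ} {k : ℕ} (hμ : μ ∈ IDLog k) {j : ℕ} (hj : j ≤ k) :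
    Integrable (fun x : ℝ => Real.log (1 + |x|) ^ (j + 1)) μ := by
  have := hμ.1.1
  have hlog := log_one_add_abs_nonneg
  refine Integrable.mono' ((integrable_const 1).add hμ.2)
    (Measurable.aestronglyMeasurable (by fun_prop)) (Eventually.of_forall fun x => ?_)
  rw [Real.norm_of_nonneg (pow_nonneg (hlog x) _)]
  simp only [Pi.add_apply]
  rcases le_total (Real.log (1 + |x|)) 1 with h1 | h1
  · linarith [pow_le_one₀ (n := j + 1) (hlog x) h1, pow_nonneg (hlog x) (k + 1)]
  · linarith [pow_le_pow_right₀ h1 (show j + 1 ≤ k + 1 by omega)]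

lemma IDLog_anti {j k : ℕ} (hj : j ≤ k) : IDLog k ⊆ IDLog j :=
  fun _ hμ => ⟨hμ.1, integrable_log_pow hμ hj⟩

/-- By the layer cake formula, the tail part integrates to `∫ (2 log(1+|x|))^{j+1}/(j+1) dμ`, which
is where the log moment enters. -/
lemma integrableOn_decayWeight_mul_pow {μ : Measure ℝ} {k : ℕ} (hμ : μ ∈ IDLog k) {j : ℕ}
    (hj : j ≤ k) : IntegrableOn (fun t => decayWeight μ t * t ^ j) (Ioi 0) := by
  have := hμ.1.1
  have hlog := log_one_add_abs_nonneg
  have hint := integrable_log_pow hμ hj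
  have hexp : IntegrableOn (fun t => Real.exp (-(t / 2)) * t ^ j) (Ioi 0) := by
    have := integrableOn_rpow_mul_exp_neg_mul_rpow (s := (j : ℝ)) (p := 1) (b := 1 / 2)
      (by linarith [Nat.cast_nonneg (α := ℝ) j]) one_pos (by norm_num)
    refine this.congr_fun (fun t ht => ?_) measurableSet_Ioi
    simp only [Real.rpow_natCast, Real.rpow_one]
    rw [mul_comm]
    ring_nf
  have htail : IntegrableOn (fun t => μ.real {x | t ≤ 2 * Real.log (1 + |x|)} * t ^ j)
      (Ioi 0) := by
    refine ⟨?_, ?_⟩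
    · refine Measurable.aestronglyMeasurable (Measurable.mul (Antitone.measurable ?_) (by fun_prop))
      exact fun s t hst => measureReal_mono fun x hx => hst.trans hx
    have hlc := lintegral_comp_eq_lintegral_meas_le_mul μ
      (f := fun x : ℝ => 2 * Real.log (1 + |x|)) (g := fun t => t ^ j)
      (Eventually.of_forall fun x => by have := hlog x; simp only [Pi.zero_apply]; positivity)
      (by fun_prop) (fun t _ => (by fun_prop : Continuous fun t : ℝ => t ^ j).intervalIntegrable _ _)
      ((ae_restrict_iff' measurableSet_Ioi).2 (Eventually.of_forall fun t ht => pow_nonneg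
        (le_of_lt ht) _))
    have hfin : ∫⁻ x : ℝ, ENNReal.ofReal (∫ t in (0 : ℝ)..2 * Real.log (1 + |x|), t ^ j) ∂μ < ⊤ := by
      have h2 : Integrable (fun x : ℝ => ∫ t in (0 : ℝ)..2 * Real.log (1 + |x|), t ^ j) μ := by
        refine (hint.const_mul (2 ^ (j + 1) / (j + 1))).congr (Eventually.of_forall fun x => ?_)
        simp only [integral_pow]
        rw [mul_pow]
        simp
        ring
      exact h2.lintegral_lt_top
    rw [hlc] at hfin
    refine lt_of_le_of_lt (le_of_eq ?_) hfin
    refine setLIntegral_congr_fun measurableSet_Ioi fun t ht => ?_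
    simp only
    have ht' : (0 : ℝ) ≤ t := le_of_lt ht
    rw [Real.enorm_eq_ofReal (by positivity), ENNReal.ofReal_mul measureReal_nonneg,
      ofReal_measureReal]
  refine (htail.add hexp).congr (Eventually.of_forall fun t => ?_)
  simp [decayWeight, add_mul]

/-- Split at `1 + |x| = e^{t/2}`. Beyond it the integrand is at most 2; below it `|e^{-t}ux| ≤
|u|e^{-t/2}`. -/
lemma norm_charFun_sub_one_le_decayWeight (μ : Measure ℝ) [IsProbabilityMeasure μ] (t u : ℝ) :
    ‖charFun μ (Real.exp (-t) * u) - 1‖ ≤ 2 * (1 + |u|) * decayWeight μ t := by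
  set A : Set ℝ := {x | t ≤ 2 * Real.log (1 + |x|)} with hA
  have hAm : MeasurableSet A := measurableSet_le measurable_const (by fun_prop)
  have hi : Integrable (fun x : ℝ =>
      Complex.exp ((Real.exp (-t) * u : ℝ) * x * Complex.I)) μ := by
    refine Integrable.of_bound (C := 1) (by fun_prop) (Eventually.of_forall fun x => ?_)
    rw [← Complex.ofReal_mul, Complex.norm_exp_ofReal_mul_I]
  have h1 : charFun μ (Real.exp (-t) * u) - 1
      = ∫ x : ℝ, (Complex.exp ((Real.exp (-t) * u : ℝ) * x * Complex.I) - 1) ∂μ := by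
    rw [integral_sub hi (integrable_const _), charFun_apply_real]
    simp
  have h2 : ‖∫ x : ℝ, (Complex.exp ((Real.exp (-t) * u : ℝ) * x * Complex.I) - 1) ∂μ‖
      ≤ ∫ x, (A.indicator (fun _ => (2 : ℝ)) x + |u| * Real.exp (-(t / 2))) ∂μ := by
    refine norm_integral_le_of_norm_le
      (((integrable_const _).indicator hAm).add (integrable_const _))
      (Eventually.of_forall fun x => ?_)
    rw [← Complex.ofReal_mul]
    by_cases hx : x ∈ A
    · rw [indicator_of_mem hx]
      have : ‖Complex.exp (((Real.exp (-t) * u * x : ℝ) : ℂ) * Complex.I) - 1‖ ≤ 2 := by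
        refine (norm_sub_le _ _).trans ?_
        rw [Complex.norm_exp_ofReal_mul_I]
        norm_num
      have h3 : 0 ≤ |u| * Real.exp (-(t / 2)) := by positivity
      linarith
    · rw [indicator_of_notMem hx, zero_add]
      refine (norm_exp_sub_one_le_of_re_nonpos
        (by rw [Complex.re_ofReal_mul]; simp)).trans ?_
      have hx' : 2 * Real.log (1 + |x|) < t := not_le.1 hx
      have hpos : (0 : ℝ) < 1 + |x| := by positivity
      have h4 : |x| ≤ Real.exp (t / 2) := by
        have : 1 + |x| < Real.exp (t / 2) := (Real.log_lt_iff_lt_exp hpos).1 (by linarith)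
        linarith
      have h5 : Real.exp (-t) * Real.exp (t / 2) = Real.exp (-(t / 2)) := by
        rw [← Real.exp_add]; ring_nf
      rw [norm_mul, Complex.norm_I, mul_one, Complex.norm_real, Real.norm_eq_abs, abs_mul,
        abs_mul, Real.abs_exp, ← h5]
      calc Real.exp (-t) * |u| * |x| ≤ Real.exp (-t) * |u| * Real.exp (t / 2) := by gcongr
        _ = _ := by ring
  rw [h1]
  refine h2.trans ?_
  rw [integral_add ((integrable_const _).indicator hAm) (integrable_const _),
    integral_indicator_const _ hAm]
  simp only [integral_const, smul_eq_mul, probReal_univ, one_mul]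
  have h6 : 0 ≤ μ.real A := measureReal_nonneg
  have h7 := Real.exp_pos (-(t / 2))
  rw [decayWeight, ← hA]
  nlinarith [abs_nonneg u, mul_nonneg (abs_nonneg u) h6, mul_nonneg (abs_nonneg u) h7.le]

lemma IsLevyExponent.exists_norm_le_decayWeight {ψ : ℝ → ℂ} (h : IsLevyExponent ψ)
    {μ : Measure ℝ} [IsProbabilityMeasure μ] (hμ : ∀ u, charFun μ u = Complex.exp (ψ u)) :
    ∃ C, 0 ≤ C ∧ ∀ t u : ℝ, 0 ≤ t →
      ‖ψ (Real.exp (-t) * u)‖ ≤ C * (1 + |u|) ^ 3 * decayWeight μ t := by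
  obtain ⟨C, hC0, hC⟩ := h.exists_norm_le
  obtain ⟨δ, hδ, hnear⟩ : ∃ δ > 0, ∀ v : ℝ, |v| < δ → ‖ψ v‖ ≤ 1 / 2 := by
    have := Metric.continuousAt_iff.1 (h.continuous.continuousAt (x := 0)) (1 / 2) (by norm_num)
    obtain ⟨δ, hδ, hv⟩ := this
    refine ⟨δ, hδ, fun v hvδ => ?_⟩
    have := hv (x := v) (by simpa using hvδ)
    rw [h.zero, dist_zero_right] at this
    exact this.le
  refine ⟨4 + C / δ, by positivity, fun t u ht => ?_⟩
  have hw := decayWeight_pos μ t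
  have hcube : 1 + |u| ≤ (1 + |u|) ^ 3 :=
    le_self_pow₀ (by linarith [abs_nonneg u]) (by norm_num)
  -- Near 0, `ψ` is comparable with `φ - 1`. Away from 0, `|e^{-t}u| ≥ δ` forces `1 ≤ |u|/δ` times
  -- the weight; this extra factor `|u|` on top of quadratic growth explains the cube.
  rcases lt_or_ge |Real.exp (-t) * u| δ with hlt | hge
  · have h1 := hnear _ hlt
    set z := ψ (Real.exp (-t) * u) with hz
    -- Since `|z| ≤ 1/2`, the remainder is at most `|z|² ≤ |z|/2` and is absorbed on the left.
    have h2 := Complex.norm_exp_sub_one_sub_id_le (x := z) (by linarith)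
    have h3 := norm_charFun_sub_one_le_decayWeight μ t u
    rw [hμ, ← hz] at h3
    have h4 : ‖z‖ ≤ ‖Complex.exp z - 1‖ + ‖Complex.exp z - 1 - z‖ := by
      have := norm_sub_le (Complex.exp z - 1) (Complex.exp z - 1 - z)
      rwa [sub_sub_cancel] at this
    have h5 : ‖z‖ ≤ 4 * (1 + |u|) * decayWeight μ t := by nlinarith [norm_nonneg z]
    refine h5.trans ?_
    have : 0 ≤ C / δ := by positivity
    gcongr
    linarith
  · have h1 := hC (Real.exp (-t) * u)
    have hexp1 : Real.exp (-t) ≤ 1 := Real.exp_le_one_iff.2 (by linarith)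
    have h2 : (Real.exp (-t) * u) ^ 2 ≤ u ^ 2 := by
      rw [mul_pow]
      have : Real.exp (-t) ^ 2 ≤ 1 := pow_le_one₀ (Real.exp_pos _).le hexp1
      nlinarith [sq_nonneg u]
    rw [abs_mul, Real.abs_exp] at hge
    have h3 : Real.exp (-t) ≤ decayWeight μ t := by
      have : Real.exp (-t) ≤ Real.exp (-(t / 2)) := Real.exp_le_exp.2 (by linarith)
      exact this.trans (le_add_of_nonneg_left measureReal_nonneg)
    have h4 : 1 ≤ |u| / δ * decayWeight μ t := by
      rw [div_mul_eq_mul_div, le_div_iff₀ hδ, one_mul, mul_comm]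
      exact hge.trans (mul_le_mul_of_nonneg_right h3 (abs_nonneg u))
    have h5 : (1 + u ^ 2) * |u| ≤ (1 + |u|) ^ 3 := by
      rw [← sq_abs]
      nlinarith [abs_nonneg u, sq_nonneg |u|]
    calc ‖ψ (Real.exp (-t) * u)‖ ≤ C * (1 + u ^ 2) * 1 := by
          rw [mul_one]; exact h1.trans (by gcongr)
      _ ≤ C * (1 + u ^ 2) * (|u| / δ * decayWeight μ t) := by gcongr
      _ = C / δ * ((1 + u ^ 2) * |u|) * decayWeight μ t := by ring
      _ ≤ C / δ * (1 + |u|) ^ 3 * decayWeight μ t := by gcongr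
      _ ≤ _ := by gcongr; linarith

/-! ### Riemann sums on equal partitions. -/

/-- `j`-th node of the partition of `[S,T]` into `n + 1` equal intervals. -/
noncomputable def gridPoint (S T : ℝ) (n : ℕ) (j : ℝ) : ℝ := S + j * ((T - S) / (n + 1 : ℕ))

/-- Number of the interval `(p_{j-1}, p_j]` of the partition which contains `t`. -/
noncomputable def gridIndex (S T : ℝ) (n : ℕ) (t : ℝ) : ℤ := ⌈(t - S) * ((n + 1 : ℕ) / (T - S))⌉

section Grid

variable {S T : ℝ}

lemma gridPoint_monotone (hST : S ≤ T) (n : ℕ) : Monotone (gridPoint S T n) := by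
  intro i j hij
  have : 0 ≤ (T - S) / (n + 1 : ℕ) := div_nonneg (sub_nonneg.2 hST) (Nat.cast_nonneg _)
  unfold gridPoint
  gcongr

@[simp] lemma gridPoint_zero (n : ℕ) : gridPoint S T n 0 = S := by simp [gridPoint]

lemma gridPoint_last (n : ℕ) : gridPoint S T n (n + 1 : ℕ) = T := by
  have hN : ((n + 1 : ℕ) : ℝ) ≠ 0 := Nat.cast_ne_zero.2 n.succ_ne_zero
  rw [gridPoint, mul_div_cancel₀ _ hN]
  ring

lemma le_gridPoint (hST : S ≤ T) (n j : ℕ) : S ≤ gridPoint S T n j := by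
  simpa using gridPoint_monotone hST n (Nat.cast_nonneg (α := ℝ) j)

lemma gridPoint_mem_Icc (hST : S ≤ T) {n j : ℕ} (hj : j ≤ n + 1) :
    gridPoint S T n j ∈ Icc S T := by
  refine ⟨le_gridPoint hST n j, ?_⟩
  have := gridPoint_monotone hST n (Nat.cast_le (α := ℝ).2 hj)
  rwa [gridPoint_last] at this

lemma gridIndex_eq (hST : S < T) {n j : ℕ} {t : ℝ}
    (ht : t ∈ Ioc (gridPoint S T n j) (gridPoint S T n (j + 1 : ℕ))) :
    gridIndex S T n t = j + 1 := by
  have hd : 0 < T - S := sub_pos.2 hST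
  have hN : (0 : ℝ) < ((n + 1 : ℕ) : ℝ) := Nat.cast_pos.2 n.succ_pos
  unfold gridPoint at ht
  rw [gridIndex, Int.ceil_eq_iff]
  rw [← mul_div_assoc, lt_div_iff₀ hd, div_le_iff₀ hd]
  obtain ⟨h1, h2⟩ := ht
  have h1' : (j : ℝ) * ((T - S) / (n + 1 : ℕ)) < t - S := by linarith
  have h2' : t - S ≤ ((j + 1 : ℕ) : ℝ) * ((T - S) / (n + 1 : ℕ)) := by linarith
  rw [← mul_div_assoc, div_lt_iff₀ hN] at h1'
  rw [← mul_div_assoc, le_div_iff₀ hN] at h2'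
  push_cast at *
  constructor <;> linarith

lemma gridIndex_bounds (hST : S < T) (n : ℕ) (t : ℝ) :
    t ≤ gridPoint S T n (gridIndex S T n t) ∧
      gridPoint S T n (gridIndex S T n t) ≤ t + (T - S) / (n + 1 : ℕ) := by
  have hd : 0 < T - S := sub_pos.2 hST
  have hN : (0 : ℝ) < ((n + 1 : ℕ) : ℝ) := Nat.cast_pos.2 n.succ_pos
  have h1 := Int.le_ceil ((t - S) * ((n + 1 : ℕ) / (T - S)))
  have h2 := (Int.ceil_lt_add_one ((t - S) * ((n + 1 : ℕ) / (T - S)))).le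
  have hδ : 0 < (T - S) / (n + 1 : ℕ) := div_pos hd hN
  have hinv : ((n + 1 : ℕ) / (T - S) : ℝ) * ((T - S) / (n + 1 : ℕ)) = 1 := by field_simp
  have h1' := mul_le_mul_of_nonneg_right h1 hδ.le
  have h2' := mul_le_mul_of_nonneg_right h2 hδ.le
  rw [mul_assoc, hinv] at h1'
  rw [add_mul, mul_assoc, hinv] at h2'
  unfold gridPoint gridIndex
  constructor <;> linarith

lemma tendsto_mesh (S T : ℝ) : Tendsto (fun n : ℕ => (T - S) / (n + 1 : ℕ)) atTop (𝓝 0) := by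
  exact (tendsto_const_div_atTop_nhds_zero_nat (T - S)).comp (tendsto_add_atTop_nat 1)

lemma tendsto_gridPoint_right (hST : S < T) (t : ℝ) :
    Tendsto (fun n => gridPoint S T n (gridIndex S T n t)) atTop (𝓝[≥] t) := by
  refine tendsto_nhdsWithin_iff.2 ⟨?_, Eventually.of_forall fun n => (gridIndex_bounds hST n t).1⟩
  refine tendsto_of_tendsto_of_tendsto_of_le_of_le tendsto_const_nhds
    (by simpa using (tendsto_mesh S T).const_add t)
    (fun n => (gridIndex_bounds hST n t).1) fun n => (gridIndex_bounds hST n t).2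

lemma tendsto_gridPoint_left (hST : S < T) (t : ℝ) :
    Tendsto (fun n => gridPoint S T n ((gridIndex S T n t : ℝ) - 1)) atTop (𝓝 t) := by
  have h1 := (tendsto_gridPoint_right hST t).mono_right nhdsWithin_le_nhds
  have h2 := h1.sub (tendsto_mesh S T)
  rw [sub_zero] at h2
  refine h2.congr fun n => ?_
  simp only [gridPoint]
  ring

lemma stronglyMeasurable_comp_gridIndex {E : Type*} [TopologicalSpace E] (g : ℤ → E) (n : ℕ) :
    StronglyMeasurable fun t => g (gridIndex S T n t) := by
  have h1 : Measurable (gridIndex S T n) := by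
    unfold gridIndex
    exact Int.measurable_ceil.comp (by fun_prop)
  exact (StronglyMeasurable.of_discrete (f := g)).comp_measurable h1

lemma gridIndex_mem (hST : S < T) {n : ℕ} {t : ℝ} (ht : t ∈ Ioc S T) :
    ∃ j : ℕ, j ≤ n ∧ gridIndex S T n t = j + 1 := by
  have hd : 0 < T - S := sub_pos.2 hST
  have hN : (0 : ℝ) < ((n + 1 : ℕ) : ℝ) := Nat.cast_pos.2 n.succ_pos
  have h0 : 0 < gridIndex S T n t := by
    rw [gridIndex, Int.ceil_pos]
    exact mul_pos (sub_pos.2 ht.1) (div_pos hN hd)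
  have h1 : gridIndex S T n t ≤ (n + 1 : ℕ) := by
    rw [gridIndex, Int.ceil_le, ← mul_div_assoc, div_le_iff₀ hd]
    push_cast
    nlinarith [ht.2]
  refine ⟨(gridIndex S T n t - 1).toNat, by omega, by omega⟩

variable {E : Type*} [NormedAddCommGroup E] [NormedSpace ℝ E] [CompleteSpace E]

/-- Riemann sums of a bounded function, sampled at left (`e = 0`) or right (`e = 1`) end points,
against a continuous weight. -/
lemma tendsto_riemannSum (hST : S < T) {e : ℕ} (he : e ≤ 1)
    {f : ℝ → E} {w : ℝ → ℝ} (hw : Continuous w) {C : ℝ} (hC : ∀ t ∈ Icc S T, ‖f t‖ ≤ C)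
    (hf : ∀ t ∈ Icc S T,
      Tendsto (fun n => f (gridPoint S T n ((gridIndex S T n t : ℝ) - 1 + e))) atTop (𝓝 (f t))) :
    Tendsto (fun n : ℕ => ∑ j ∈ Finset.range (n + 1),
      (∫ t in gridPoint S T n j..gridPoint S T n (j + 1 : ℕ), w t) • f (gridPoint S T n (j + e : ℕ)))
      atTop (𝓝 (∫ t in S..T, w t • f t)) := by
  -- The sum is the integral of a step function. On the interval with nodes `j` and `j+1` the index
  -- is `j+1`, so the offset `-1 + e` samples node `j + e`.
  set F : ℕ → ℝ → E := fun n t => w t • f (gridPoint S T n ((gridIndex S T n t : ℝ) - 1 + e))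
    with hF
  have hFm : ∀ n, AEStronglyMeasurable (F n) volume := fun n =>
    hw.aestronglyMeasurable.smul (stronglyMeasurable_comp_gridIndex
      (fun i : ℤ => f (gridPoint S T n ((i : ℝ) - 1 + e))) n).aestronglyMeasurable
  have hFC : ∀ n, ∀ t ∈ Ioc S T, ‖F n t‖ ≤ ‖w t‖ * C := by
    intro n t ht
    obtain ⟨j, hj, hjt⟩ := gridIndex_mem hST (n := n) ht
    rw [hF]
    simp only [hjt, norm_smul]
    refine mul_le_mul_of_nonneg_left (hC _ ?_) (norm_nonneg _)
    have := gridPoint_mem_Icc hST.le (n := n) (j := j + e) (by omega)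
    push_cast at this ⊢
    rwa [add_sub_cancel_right]
  have hwC : IntervalIntegrable (fun t => ‖w t‖ * C) volume S T :=
    (hw.norm.mul continuous_const).intervalIntegrable _ _
  have hFi : ∀ n, IntervalIntegrable (F n) volume S T := by
    intro n
    refine hwC.mono_fun (hFm n).restrict ?_
    refine (ae_restrict_iff' measurableSet_uIoc).2 (Eventually.of_forall fun t ht => ?_)
    rw [uIoc_of_le hST.le] at ht
    exact (hFC n t ht).trans (le_abs_self _)
  have hsum : ∀ n : ℕ, ∑ j ∈ Finset.range (n + 1),
      (∫ t in gridPoint S T n j..gridPoint S T n (j + 1 : ℕ), w t) • f (gridPoint S T n (j + e : ℕ))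
      = ∫ t in S..T, F n t := by
    intro n
    have h1 := intervalIntegral.sum_integral_adjacent_intervals (f := F n) (μ := volume)
      (a := fun j : ℕ => gridPoint S T n j) (n := n + 1) (fun j hj => (hFi n).mono_set (by
        rw [uIcc_of_le hST.le, uIcc_of_le (gridPoint_monotone hST.le n (by simp))]
        exact Icc_subset_Icc (gridPoint_mem_Icc hST.le (by omega)).1
          (gridPoint_mem_Icc hST.le (by omega)).2))
    rw [gridPoint_last, Nat.cast_zero, gridPoint_zero] at h1
    rw [← h1]
    refine Finset.sum_congr rfl fun j _ => ?_
    rw [← intervalIntegral.integral_smul_const]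
    refine intervalIntegral.integral_congr_ae (Eventually.of_forall fun t ht => ?_)
    rw [uIoc_of_le (gridPoint_monotone hST.le n (by simp))] at ht
    simp only [hF, gridIndex_eq hST ht]
    push_cast
    rw [add_sub_cancel_right]
  simp only [hsum]
  refine intervalIntegral.tendsto_integral_filter_of_dominated_convergence (fun t => ‖w t‖ * C)
    (Eventually.of_forall fun n => (hFm n).restrict) (Eventually.of_forall fun n => ?_) hwC ?_
  · refine Eventually.of_forall fun t ht => ?_
    rw [uIoc_of_le hST.le] at ht
    exact hFC n t ht
  · refine Eventually.of_forall fun t ht => ?_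
    rw [uIoc_of_le hST.le] at ht
    exact (hf t (Ioc_subset_Icc_self ht)).const_smul _

lemma tendsto_riemannSum_right (hST : S < T) {f : ℝ → E} {w : ℝ → ℝ}
    (hw : Continuous w) {C : ℝ} (hC : ∀ t ∈ Icc S T, ‖f t‖ ≤ C)
    (hf : ∀ t ∈ Icc S T, ContinuousWithinAt f (Ici t) t) :
    Tendsto (fun n : ℕ => ∑ j ∈ Finset.range (n + 1),
      (∫ t in gridPoint S T n j..gridPoint S T n (j + 1 : ℕ), w t) • f (gridPoint S T n (j + 1 : ℕ)))
      atTop (𝓝 (∫ t in S..T, w t • f t)) := by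
  refine tendsto_riemannSum hST le_rfl hw hC fun t ht => ?_
  simpa [Function.comp_def] using (hf t ht).tendsto.comp (tendsto_gridPoint_right hST t)

lemma tendsto_riemannSum_left (hST : S < T) {f : ℝ → E} {w : ℝ → ℝ}
    (hw : Continuous w) (hf : Continuous f) :
    Tendsto (fun n : ℕ => ∑ j ∈ Finset.range (n + 1),
      (∫ t in gridPoint S T n j..gridPoint S T n (j + 1 : ℕ), w t) • f (gridPoint S T n j))
      atTop (𝓝 (∫ t in S..T, w t • f t)) := by
  obtain ⟨C, hC⟩ := isCompact_Icc.exists_bound_of_continuousOn (s := Icc S T) hf.continuousOn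
  refine tendsto_riemannSum hST zero_le_one hw hC fun t ht => ?_
  simpa [Function.comp_def] using (hf.tendsto t).comp (tendsto_gridPoint_left hST t)

/-- Measurability holds because `f` is the pointwise limit of step functions sampled at nodes to the
right. -/
lemma intervalIntegrable_of_rightContinuous {E : Type*} [NormedAddCommGroup E] (hST : S < T)
    {f : ℝ → E} {C : ℝ}
    (hC : ∀ t ∈ Icc S T, ‖f t‖ ≤ C) (hf : ∀ t ∈ Icc S T, ContinuousWithinAt f (Ici t) t) :
    IntervalIntegrable f volume S T := by
  have hm : AEStronglyMeasurable f (volume.restrict (Ioc S T)) := by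
    refine aestronglyMeasurable_of_tendsto_ae atTop
      (f := fun n t => f (gridPoint S T n (gridIndex S T n t)))
      (fun n => (stronglyMeasurable_comp_gridIndex
        (fun i : ℤ => f (gridPoint S T n i)) n).aestronglyMeasurable)
      ((ae_restrict_iff' measurableSet_Ioc).2 (Eventually.of_forall fun t ht =>
        (hf t (Ioc_subset_Icc_self ht)).tendsto.comp (tendsto_gridPoint_right hST t)))
  rw [intervalIntegrable_iff_integrableOn_Ioc_of_le hST.le]
  exact Integrable.of_bound hm C ((ae_restrict_iff' measurableSet_Ioc).2
    (Eventually.of_forall fun t ht => hC t (Ioc_subset_Icc_self ht)))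

end Grid

/-! ### The pathwise integral and its characteristic function. -/

/-- One-sided limits give local bounds, and compactness makes them uniform. -/
lemma bounded_of_cadlag {y : ℝ≥0 → ℝ} (hr : ∀ t, ContinuousWithinAt y (Ici t) t)
    (hl : ∀ t, ∃ l : ℝ, Tendsto y (𝓝[<] t) (𝓝 l)) (b : ℝ≥0) :
    ∃ C, ∀ t ≤ b, ‖y t‖ ≤ C := by
  have hloc : ∀ {l : ℝ} {F : Filter ℝ≥0}, Tendsto y F (𝓝 l) → ∀ᶠ s in F, ‖y s‖ ≤ ‖l‖ + 1 :=
    fun h => h.norm.eventually (eventually_le_nhds (lt_add_one _))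
  obtain ⟨C, hC⟩ := (isCompact_Icc (a := 0) (b := b)).induction_on
    (p := fun s => ∃ C, ∀ t ∈ s, ‖y t‖ ≤ C) ⟨0, by simp⟩
    (fun s t hst ⟨C, hC⟩ => ⟨C, fun x hx => hC x (hst hx)⟩)
    (fun s t ⟨C, hC⟩ ⟨D, hD⟩ => ⟨max C D, fun x hx => hx.elim
      (fun h => (hC x h).trans (le_max_left _ _)) fun h => (hD x h).trans (le_max_right _ _)⟩)
    (fun t _ => by
      obtain ⟨l, hl⟩ := hl t
      have h1 := hloc hl
      have h2 := hloc (hr t).tendsto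
      have h3 : ∀ᶠ s in 𝓝 t, ‖y s‖ ≤ max (‖l‖ + 1) (‖y t‖ + 1) := by
        rw [← nhdsLT_sup_nhdsGE, eventually_sup]
        exact ⟨h1.mono fun s hs => hs.trans (le_max_left _ _),
          h2.mono fun s hs => hs.trans (le_max_right _ _)⟩
      exact ⟨_, mem_nhdsWithin_of_mem_nhds h3, _, fun s hs => hs⟩)
  exact ⟨C, fun t ht => hC t ⟨zero_le, ht⟩⟩

lemma timeChange_continuous (k : ℕ) : Continuous (timeChange k) := by
  unfold timeChange
  fun_prop

lemma timeChange_mono (k : ℕ) {s t : ℝ} (hs : 0 ≤ s) (hst : s ≤ t) :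
    timeChange k s ≤ timeChange k t := by
  unfold timeChange
  gcongr

lemma coe_timeChange (k : ℕ) {t : ℝ} (ht : 0 ≤ t) :
    (timeChange k t : ℝ) = t ^ (k + 1) / (k + 1)! :=
  Real.coe_toNNReal _ (by positivity)

lemma coe_timeChange_sub (k : ℕ) {s t : ℝ} (hs : 0 ≤ s) (hst : s ≤ t) :
    ((timeChange k t - timeChange k s : ℝ≥0) : ℝ) = ∫ x in s..t, x ^ k / k ! := by
  rw [NNReal.coe_sub (timeChange_mono k hs hst), coe_timeChange k hs,
    coe_timeChange k (hs.trans hst), intervalIntegral.integral_div, integral_pow,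
    Nat.factorial_succ]
  push_cast
  field_simp

/-- Riemann–Stieltjes sum of `∫_{(S,T]} e^{-t} dY(r_k(t))`. -/
noncomputable def stieltjesSum (k : ℕ) (y : ℝ≥0 → ℝ) (S T : ℝ) (n : ℕ) : ℝ :=
  ∑ j ∈ Finset.range (n + 1), Real.exp (-gridPoint S T n j) *
    (y (timeChange k (gridPoint S T n (j + 1 : ℕ))) - y (timeChange k (gridPoint S T n j)))

lemma expIntegral_zero {Ω : Type} (k : ℕ) (Y : ℝ≥0 → Ω → ℝ) (ω : Ω) : expIntegral k Y 0 ω = 0 := by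
  simp [expIntegral]

namespace IsLevyProcess

variable {Ω : Type} [MeasurableSpace Ω] {P : Measure Ω} {Y : ℝ≥0 → Ω → ℝ} {k : ℕ} {S T : ℝ}

lemma continuousWithinAt_timeChange (h : IsLevyProcess Y P) (ω : Ω) {t : ℝ} (ht : 0 ≤ t) :
    ContinuousWithinAt (fun t => Y (timeChange k t) ω) (Ici t) t := by
  refine (h.right_cont ω (timeChange k t)).comp
    (timeChange_continuous k).continuousWithinAt fun s hs => ?_
  exact timeChange_mono k ht hs

lemma bounded_timeChange (h : IsLevyProcess Y P) (ω : Ω) (k : ℕ) (T : ℝ) :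
    ∃ C, ∀ t ∈ Icc 0 T, ‖Y (timeChange k t) ω‖ ≤ C := by
  obtain ⟨C, hC⟩ := bounded_of_cadlag (h.right_cont ω) (h.left_lim ω) (timeChange k T)
  exact ⟨C, fun t ht => hC _ (timeChange_mono k ht.1 ht.2)⟩

lemma expIntegral_sub (h : IsLevyProcess Y P) (hS : 0 ≤ S) (hST : S < T) (ω : Ω) :
    expIntegral k Y T ω - expIntegral k Y S ω =
      Real.exp (-T) * Y (timeChange k T) ω - Real.exp (-S) * Y (timeChange k S) ω
        + ∫ t in S..T, Real.exp (-t) • Y (timeChange k t) ω := by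
  have hT : 0 < T := hS.trans_lt hST
  obtain ⟨C, hC⟩ := h.bounded_timeChange ω k T
  have hi : IntervalIntegrable (fun t => Y (timeChange k t) ω) volume 0 T :=
    intervalIntegrable_of_rightContinuous hT hC
      fun t ht => h.continuousWithinAt_timeChange ω ht.1
  have hi2 : IntervalIntegrable (fun t => Y (timeChange k t) ω * Real.exp (-t)) volume 0 T :=
    hi.mul_continuousOn (by fun_prop)
  have hi3 : IntervalIntegrable (fun t => Y (timeChange k t) ω * Real.exp (-t)) volume 0 S :=
    hi2.mono_set (by
      rw [uIcc_of_le hS, uIcc_of_le hT.le]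
      exact Icc_subset_Icc le_rfl hST.le)
  have := intervalIntegral.integral_interval_sub_left hi2 hi3
  simp only [smul_eq_mul, mul_comm (Real.exp _)]
  rw [← this]
  simp only [expIntegral]
  ring

/-- Summation by parts: with nodes `p_j` and values `y_j`, `e^{-p_j}(y_{j+1} - y_j)` is the
increment of `e^{-p_j}y_j` plus `(e^{-p_j} - e^{-p_{j+1}}) y_{j+1}`. Only right end points are
sampled, so right continuity suffices. -/
lemma tendsto_stieltjesSum (h : IsLevyProcess Y P) (hS : 0 ≤ S) (hST : S < T) (ω : Ω) :
    Tendsto (fun n => stieltjesSum k (fun t => Y t ω) S T n) atTop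
      (𝓝 (expIntegral k Y T ω - expIntegral k Y S ω)) := by
  obtain ⟨C, hC⟩ := h.bounded_timeChange ω k T
  have h1 := tendsto_riemannSum_right hST (f := fun t => Y (timeChange k t) ω)
    (w := fun t => Real.exp (-t)) (by fun_prop) (C := C)
    (fun t ht => hC t ⟨hS.trans ht.1, ht.2⟩)
    (fun t ht => h.continuousWithinAt_timeChange ω (hS.trans ht.1))
  rw [h.expIntegral_sub hS hST]
  refine (h1.const_add _).congr fun n => ?_
  have htel := Finset.sum_range_sub
    (fun j : ℕ => Real.exp (-gridPoint S T n j) * Y (timeChange k (gridPoint S T n j)) ω) (n + 1)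
  rw [gridPoint_last, Nat.cast_zero, gridPoint_zero] at htel
  rw [← htel, stieltjesSum, ← Finset.sum_add_distrib]
  refine Finset.sum_congr rfl fun j _ => ?_
  rw [show (fun t : ℝ => Real.exp (-t)) = fun t => Real.exp ((-1) * t) by simp]
  have hint : ∫ t in gridPoint S T n j..gridPoint S T n (j + 1 : ℕ), Real.exp (-1 * t)
      = Real.exp (-gridPoint S T n j) - Real.exp (-gridPoint S T n (j + 1 : ℕ)) := by
    rw [intervalIntegral.integral_comp_mul_left (fun x => Real.exp x) (by norm_num), integral_exp]
    simp
  rw [hint, smul_eq_mul]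
  ring

lemma measurable_stieltjesSum (h : IsLevyProcess Y P) (n : ℕ) :
    Measurable fun ω => stieltjesSum k (fun t => Y t ω) S T n := by
  have := h.measurable
  unfold stieltjesSum
  fun_prop

/-- The integral is a pointwise limit of finite sums of measurable variables. -/
lemma measurable_expIntegral (h : IsLevyProcess Y P) (hT : 0 ≤ T) :
    Measurable (expIntegral k Y T) := by
  rcases hT.eq_or_lt with rfl | hT
  · rw [show expIntegral k Y 0 = fun _ => 0 from funext (expIntegral_zero k Y)]
    exact measurable_const
  · refine measurable_of_tendsto_metrizable (fun n => h.measurable_stieltjesSum (k := k)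
      (S := 0) (T := T) n) (tendsto_pi_nhds.2 fun ω => ?_)
    simpa [expIntegral_zero] using h.tendsto_stieltjesSum (k := k) le_rfl hT ω

/-- Independent increments give a product, and the clock `r_k` advances by `∫ t^k/k! dt` on each
interval. The exponent is thus a left-point Riemann sum. -/
lemma charFun_stieltjesSum [IsProbabilityMeasure P] (h : IsLevyProcess Y P) {ψ : ℝ → ℂ}
    (hψ : ∀ (t : ℝ≥0) (u : ℝ), charFun (P.map (Y t)) u = Complex.exp (t * ψ u))
    (hS : 0 ≤ S) (hST : S < T) (n : ℕ) (u : ℝ) :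
    charFun (P.map fun ω => stieltjesSum k (fun t => Y t ω) S T n) u =
      Complex.exp (∑ j ∈ Finset.range (n + 1),
        (∫ t in gridPoint S T n j..gridPoint S T n (j + 1 : ℕ), t ^ k / k !) •
          ψ (Real.exp (-gridPoint S T n j) * u)) := by
  have hm := h.measurable
  have hmono : Monotone fun j : ℕ => timeChange k (gridPoint S T n j) := fun i j hij =>
    timeChange_mono k (hS.trans (le_gridPoint hST.le n i))
      (gridPoint_monotone hST.le n (Nat.cast_le.2 hij))
  have hind := (h.indep.nat hmono).comp (fun j x => Real.exp (-gridPoint S T n j) * x)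
    (fun j => by fun_prop)
  have h1 := congrFun (iIndepFun.charFun_map_fun_finsetSum_eq_prod
    (s := Finset.range (n + 1)) (P := P)
    (X := fun (j : ℕ) ω => Real.exp (-gridPoint S T n j) *
    (Y (timeChange k (gridPoint S T n (j + 1 : ℕ))) ω - Y (timeChange k (gridPoint S T n j)) ω))
    (fun j _ => by fun_prop) (hind.restrict _)) u
  unfold stieltjesSum
  rw [h1, Finset.prod_apply, Complex.exp_sum]
  refine Finset.prod_congr rfl fun j _ => ?_
  have hle : timeChange k (gridPoint S T n j) ≤ timeChange k (gridPoint S T n (j + 1 : ℕ)) :=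
    hmono j.le_succ
  rw [charFun_map_mul_comp (by fun_prop), h.map_increment hle, hψ, ← coe_timeChange_sub k
    (hS.trans (le_gridPoint hST.le n j)) (gridPoint_monotone hST.le n (by simp)),
    Complex.real_smul]

/-- Characteristic function of the random integral over `(S,T]`. -/
lemma charFun_expIntegral_sub [IsProbabilityMeasure P] (h : IsLevyProcess Y P) {ψ : ℝ → ℂ}
    (hψc : Continuous ψ)
    (hψ : ∀ (t : ℝ≥0) (u : ℝ), charFun (P.map (Y t)) u = Complex.exp (t * ψ u))
    (hS : 0 ≤ S) (hST : S < T) (u : ℝ) :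
    charFun (P.map fun ω => expIntegral k Y T ω - expIntegral k Y S ω) u =
      Complex.exp (∫ t in S..T, (t ^ k / k ! : ℝ) • ψ (Real.exp (-t) * u)) := by
  have h1 : Tendsto (fun n => charFun (P.map fun ω => stieltjesSum k (fun t => Y t ω) S T n) u)
      atTop (𝓝 (charFun (P.map fun ω => expIntegral k Y T ω - expIntegral k Y S ω) u)) := by
    have e : ∀ {X : Ω → ℝ}, Measurable X →
        charFun (P.map X) u = ∫ ω, Complex.exp (u * X ω * Complex.I) ∂P := by
      intro X hX
      rw [charFun_apply_real, integral_map hX.aemeasurable (by fun_prop)]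
    have hTm := h.measurable_expIntegral (k := k) (hS.trans hST.le)
    have hSm := h.measurable_expIntegral (k := k) hS
    have hXm : Measurable fun ω => expIntegral k Y T ω - expIntegral k Y S ω := hTm.sub hSm
    rw [e hXm]
    simp only [e (h.measurable_stieltjesSum _)]
    refine tendsto_integral_of_dominated_convergence (fun _ => 1) (fun n => ?_)
      (integrable_const _) (fun n => Eventually.of_forall fun ω => ?_)
      (Eventually.of_forall fun ω => ?_)
    · have := h.measurable_stieltjesSum (k := k) (S := S) (T := T) n
      exact Measurable.aestronglyMeasurable (by fun_prop)
    · rw [← Complex.ofReal_mul, Complex.norm_exp_ofReal_mul_I]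
    · have h2 : Continuous fun y : ℝ => Complex.exp (u * y * Complex.I) := by fun_prop
      exact (h2.tendsto _).comp (h.tendsto_stieltjesSum hS hST ω)
  refine tendsto_nhds_unique h1 ?_
  simp only [h.charFun_stieltjesSum hψ hS hST]
  refine (Complex.continuous_exp.tendsto _).comp (tendsto_riemannSum_left hST
    (f := fun t => ψ (Real.exp (-t) * u)) (by fun_prop) (by fun_prop))

end IsLevyProcess

/-! ### The iterated exponent. -/

/-- Integrability of `t ↦ t^j ψ(e^{-t}u)` on `(0,∞)` for `j ≤ k`, with a majorant which is
locally uniform in `u`. -/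
structure HasDecay (k : ℕ) (ψ : ℝ → ℂ) (w : ℝ → ℝ) : Prop where
  continuous : Continuous ψ
  zero : ψ 0 = 0
  bound : ∀ t u : ℝ, 0 ≤ t → ‖ψ (Real.exp (-t) * u)‖ ≤ (1 + |u|) ^ 3 * w t
  integrable : ∀ j ≤ k, IntegrableOn (fun t => w t * (t ^ j / j !)) (Ioi 0)

/-- `∫_0^∞ ψ(e^{-t}u) t^k/k! dt`. -/
noncomputable def iteratedExponent (ψ : ℝ → ℂ) (k : ℕ) (u : ℝ) : ℂ :=
  ∫ t in Ioi (0 : ℝ), (t ^ k / k ! : ℝ) • ψ (Real.exp (-t) * u)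

namespace HasDecay

variable {k j : ℕ} {ψ : ℝ → ℂ} {w : ℝ → ℝ}

lemma mono (h : HasDecay k ψ w) (hj : j ≤ k) : HasDecay j ψ w :=
  ⟨h.continuous, h.zero, h.bound, fun i hi => h.integrable i (hi.trans hj)⟩

lemma weight_nonneg (h : HasDecay k ψ w) {t : ℝ} (ht : 0 ≤ t) : 0 ≤ w t := by
  simpa using (norm_nonneg _).trans (h.bound t 0 ht)

lemma norm_smul_le (h : HasDecay k ψ w) (j : ℕ) {t : ℝ} (ht : 0 ≤ t) (u : ℝ) :
    ‖(t ^ j / j ! : ℝ) • ψ (Real.exp (-t) * u)‖ ≤ (1 + |u|) ^ 3 * (w t * (t ^ j / j !)) := by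
  have h0 : 0 ≤ t ^ j / (j ! : ℝ) := by positivity
  rw [norm_smul, Real.norm_of_nonneg h0, mul_comm, ← mul_assoc]
  exact mul_le_mul_of_nonneg_right (h.bound t u ht) h0

lemma integrableOn (h : HasDecay k ψ w) (hj : j ≤ k) (u : ℝ) :
    IntegrableOn (fun t => (t ^ j / j ! : ℝ) • ψ (Real.exp (-t) * u)) (Ioi 0) := by
  have := h.continuous
  refine Integrable.mono' ((h.integrable j hj).const_mul ((1 + |u|) ^ 3))
    (Continuous.aestronglyMeasurable (by fun_prop))
    ((ae_restrict_iff' measurableSet_Ioi).2 (Eventually.of_forall fun t ht =>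
      h.norm_smul_le j (le_of_lt ht) u))

lemma norm_iteratedExponent_le (h : HasDecay k ψ w) (hj : j ≤ k) (u : ℝ) :
    ‖iteratedExponent ψ j u‖ ≤ (1 + |u|) ^ 3 * ∫ t in Ioi (0 : ℝ), w t * (t ^ j / j !) := by
  rw [← integral_const_mul]
  refine norm_integral_le_of_norm_le ((h.integrable j hj).const_mul _)
    ((ae_restrict_iff' measurableSet_Ioi).2 (Eventually.of_forall fun t ht =>
      h.norm_smul_le j (le_of_lt ht) u))

lemma iteratedExponent_zero (h : HasDecay k ψ w) (j : ℕ) : iteratedExponent ψ j 0 = 0 := by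
  simp [iteratedExponent, h.zero]

lemma continuous_iteratedExponent (h : HasDecay k ψ w) (hj : j ≤ k) :
    Continuous (iteratedExponent ψ j) := by
  have hc := h.continuous
  refine continuous_iff_continuousAt.2 fun u => ?_
  refine continuousAt_of_dominated (bound := fun t => (1 + (|u| + 1)) ^ 3 * (w t * (t ^ j / j !)))
    (Eventually.of_forall fun v => Continuous.aestronglyMeasurable (by fun_prop)) ?_
    ((h.integrable j hj).const_mul _) (Eventually.of_forall fun t => by fun_prop)
  have hv : ∀ᶠ v in 𝓝 u, |v| < |u| + 1 :=
    (continuous_abs.tendsto u).eventually (gt_mem_nhds (lt_add_one _))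
  filter_upwards [hv] with v hv
  refine (ae_restrict_iff' measurableSet_Ioi).2 (Eventually.of_forall fun t ht => ?_)
  refine (h.norm_smul_le j (le_of_lt ht) v).trans ?_
  have := h.weight_nonneg (le_of_lt ht)
  have ht' : (0 : ℝ) ≤ t := le_of_lt ht
  gcongr

lemma tendsto_intervalIntegral (h : HasDecay k ψ w) (u : ℝ) :
    Tendsto (fun T => ∫ t in (0 : ℝ)..T, (t ^ k / k ! : ℝ) • ψ (Real.exp (-t) * u)) atTop
      (𝓝 (iteratedExponent ψ k u)) :=
  intervalIntegral_tendsto_integral_Ioi 0 (h.integrableOn le_rfl u) tendsto_id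

lemma exists_tail_le (h : HasDecay k ψ w) {η : ℝ} (hη : 0 < η) :
    ∃ T₀, 0 ≤ T₀ ∧ ∀ S T, T₀ ≤ S → S ≤ T → ∫ t in S..T, w t * (t ^ k / k !) ≤ η := by
  have hi := h.integrable k le_rfl
  have hlim := intervalIntegral_tendsto_integral_Ioi 0 hi tendsto_id
  obtain ⟨T₀, hT₀⟩ := Metric.tendsto_atTop.1 hlim (η / 2) (by positivity)
  refine ⟨max T₀ 0, le_max_right _ _, fun S T hS hST => ?_⟩
  have h1 := hT₀ S ((le_max_left _ _).trans hS)
  have h2 := hT₀ T (((le_max_left _ _).trans hS).trans hST)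
  have hS0 : 0 ≤ S := (le_max_right _ _).trans hS
  have hii : ∀ R, 0 ≤ R → IntervalIntegrable (fun t => w t * (t ^ k / k !)) volume 0 R :=
    fun R hR => (intervalIntegrable_iff_integrableOn_Ioc_of_le hR).2
      (hi.mono_set Ioc_subset_Ioi_self)
  rw [← intervalIntegral.integral_interval_sub_left (hii T (hS0.trans hST)) (hii S hS0)]
  rw [Real.dist_eq, abs_lt] at h1 h2
  simp only [id] at h1 h2
  linarith [h1.1, h2.2]

lemma norm_intervalIntegral_le (h : HasDecay k ψ w) {S T : ℝ} (hS : 0 ≤ S) (hST : S ≤ T) (u : ℝ) :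
    ‖∫ t in S..T, (t ^ k / k ! : ℝ) • ψ (Real.exp (-t) * u)‖
      ≤ (1 + |u|) ^ 3 * ∫ t in S..T, w t * (t ^ k / k !) := by
  rw [← intervalIntegral.integral_const_mul]
  refine intervalIntegral.norm_integral_le_of_norm_le hST
    (Eventually.of_forall fun t ht => h.norm_smul_le k (hS.trans ht.1.le) u) ?_
  exact ((intervalIntegrable_iff_integrableOn_Ioc_of_le hST).2
    ((h.integrable k le_rfl).mono_set fun t ht => lt_of_le_of_lt hS ht.1)).const_mul _

end HasDecay

/-! ### Existence and law of the improper integral. -/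

/-- Completeness of convergence in probability. -/
lemma exists_tendstoInMeasure_of_cauchy {Ω : Type*} [MeasurableSpace Ω] {P : Measure Ω}
    [IsProbabilityMeasure P] {X : ℝ → Ω → ℝ} (hm : ∀ T, 0 ≤ T → Measurable (X T))
    (hC : ∀ ε : ℝ, 0 < ε → ∃ T₀, ∀ S T, T₀ ≤ S → S ≤ T →
      P.real {ω | ε ≤ |X T ω - X S ω|} ≤ ε) :
    ∃ Z, Measurable Z ∧ TendstoInMeasure P X atTop Z := by
  choose! T₀ hT₀ using hC
  -- Adding 1 to each term makes `τ` increase to infinity, while `τ n` still dominates the Cauchy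
  -- threshold for `2^{-n}`.
  set τ : ℕ → ℝ := fun n => ∑ i ∈ Finset.range (n + 1), (|T₀ ((1 / 2) ^ i)| + 1) with hτ
  have hτ_nn : ∀ n, 0 ≤ τ n := fun n => Finset.sum_nonneg fun i _ => by positivity
  have hτ_succ : ∀ n, τ n ≤ τ (n + 1) := by
    intro n
    simp only [hτ, Finset.sum_range_succ _ (n + 1)]
    have : 0 ≤ |T₀ ((1 / 2) ^ (n + 1))| := abs_nonneg _
    linarith
  have hτ_ge : ∀ n, T₀ ((1 / 2) ^ n) ≤ τ n := by
    intro n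
    have h1 := Finset.single_le_sum (f := fun i => |T₀ ((1 / 2) ^ i)| + 1)
      (fun i _ => by positivity) (Finset.self_mem_range_succ n)
    have h2 := le_abs_self (T₀ ((1 / 2) ^ n))
    linarith
  have hτ_top : Tendsto τ atTop atTop := by
    refine tendsto_atTop_mono (fun n => ?_) tendsto_natCast_atTop_atTop
    calc (n : ℝ) ≤ ∑ i ∈ Finset.range (n + 1), (1 : ℝ) := by simp
      _ ≤ τ n := Finset.sum_le_sum fun i _ => by linarith [abs_nonneg (T₀ ((1 / 2) ^ i))]
  have hae : ∀ᵐ ω ∂P, ∃ l, Tendsto (fun n => X (τ n) ω) atTop (𝓝 l) := by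
    -- Borel–Cantelli: almost surely, successive differences are eventually below `2^{-n}`, so the
    -- sequence is Cauchy.
    have hbc : ∑' n, P {ω | (1 / 2 : ℝ) ^ n ≤ |X (τ (n + 1)) ω - X (τ n) ω|} ≠ ⊤ := by
      have hle : ∀ n, P {ω | (1 / 2 : ℝ) ^ n ≤ |X (τ (n + 1)) ω - X (τ n) ω|}
          ≤ ENNReal.ofReal ((1 / 2) ^ n) := by
        intro n
        rw [← ofReal_measureReal]
        exact ENNReal.ofReal_le_ofReal (hT₀ _ (by positivity) _ _ (hτ_ge n) (hτ_succ n))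
      refine ne_top_of_le_ne_top ?_ (ENNReal.tsum_le_tsum hle)
      rw [← ENNReal.ofReal_tsum_of_nonneg (fun n => by positivity) summable_geometric_two]
      exact ENNReal.ofReal_ne_top
    filter_upwards [ae_eventually_notMem hbc] with ω hω
    refine cauchySeq_tendsto_of_complete (cauchySeq_of_summable_dist ?_)
    refine Summable.of_norm_bounded_eventually_nat summable_geometric_two ?_
    filter_upwards [hω] with n hn
    rw [Real.norm_of_nonneg dist_nonneg, dist_comm, Real.dist_eq]
    exact (not_le.1 hn).le
  obtain ⟨Z, hZm, hZ⟩ := measurable_limit_of_tendsto_metrizable_ae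
    (fun n => (hm (τ n) (hτ_nn n)).aemeasurable) hae
  refine ⟨Z, hZm, ?_⟩
  have hsub := tendstoInMeasure_of_tendsto_ae
    (fun n => (hm (τ n) (hτ_nn n)).aestronglyMeasurable) hZ
  rw [tendstoInMeasure_iff_measureReal_norm] at hsub ⊢
  intro ε hε
  refine Metric.tendsto_atTop.2 fun δ hδ => ?_
  set η := min (ε / 2) (δ / 4) with hη
  have hη0 : 0 < η := by positivity
  obtain ⟨n, hn1, hn2⟩ := ((hτ_top.eventually_ge_atTop (T₀ η)).and
    ((hsub (ε / 2) (by positivity)).eventually (gt_mem_nhds (show 0 < δ / 4 by positivity)))).exists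
  refine ⟨τ n, fun T hT => ?_⟩
  rw [Real.dist_eq, sub_zero, abs_of_nonneg measureReal_nonneg]
  have h1 := hT₀ η hη0 _ T hn1 hT
  have hcover : {ω | ε ≤ ‖X T ω - Z ω‖} ⊆
      {ω | η ≤ |X T ω - X (τ n) ω|} ∪ {ω | ε / 2 ≤ ‖X (τ n) ω - Z ω‖} := by
    intro ω hω
    by_contra hcon
    simp only [mem_union, mem_ofPred_eq, not_or, not_le] at hcon hω
    have h2 := abs_add_le (X T ω - X (τ n) ω) (X (τ n) ω - Z ω)
    rw [sub_add_sub_cancel] at h2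
    simp only [Real.norm_eq_abs] at hω hcon
    linarith [min_le_left (ε / 2) (δ / 4), hcon.1, hcon.2]
  have h3 := (measureReal_mono (μ := P) hcover).trans (measureReal_union_le _ _)
  linarith [min_le_right (ε / 2) (δ / 4)]

namespace IsLevyProcess

variable {Ω : Type} [MeasurableSpace Ω] {P : Measure Ω} [IsProbabilityMeasure P]
  {Y : ℝ≥0 → Ω → ℝ} {k : ℕ} {ψ : ℝ → ℂ} {w : ℝ → ℝ}

/-- An almost surely convergent sequence of times `τ n → ∞` reduces this to bounded convergence on
finite intervals. -/
lemma charFun_of_tendstoInMeasure (h : IsLevyProcess Y P) (hd : HasDecay k ψ w)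
    (hψ : ∀ (t : ℝ≥0) (u : ℝ), charFun (P.map (Y t)) u = Complex.exp (t * ψ u))
    {Z : Ω → ℝ} (hZm : AEMeasurable Z P)
    (hZ : TendstoInMeasure P (fun T : ℝ => expIntegral k Y T) atTop Z) (u : ℝ) :
    charFun (P.map Z) u = Complex.exp (iteratedExponent ψ k u) := by
  obtain ⟨τ, hτ, hae⟩ := hZ.exists_seq_tendsto_ae'
  have hev : ∀ᶠ n in atTop, 0 < τ n := hτ.eventually_gt_atTop 0
  have e : ∀ {X : Ω → ℝ}, AEMeasurable X P →
      charFun (P.map X) u = ∫ ω, Complex.exp (u * X ω * Complex.I) ∂P := by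
    intro X hX
    rw [charFun_apply_real, integral_map hX (by fun_prop)]
  have h1 : Tendsto (fun n => ∫ ω, Complex.exp (u * expIntegral k Y (τ n) ω * Complex.I) ∂P)
      atTop (𝓝 (charFun (P.map Z) u)) := by
    rw [e hZm]
    refine tendsto_integral_filter_of_dominated_convergence (fun _ => 1) ?_ ?_
      (integrable_const _) ?_
    · filter_upwards [hev] with n hn
      have := h.measurable_expIntegral (k := k) hn.le
      exact Measurable.aestronglyMeasurable (by fun_prop)
    · refine Eventually.of_forall fun n => Eventually.of_forall fun ω => ?_
      rw [← Complex.ofReal_mul, Complex.norm_exp_ofReal_mul_I]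
    · filter_upwards [hae] with ω hω
      have h2 : Continuous fun y : ℝ => Complex.exp (u * y * Complex.I) := by fun_prop
      exact (h2.tendsto _).comp hω
  refine tendsto_nhds_unique h1 ?_
  refine ((Complex.continuous_exp.tendsto _).comp
    ((hd.tendsto_intervalIntegral u).comp hτ)).congr' ?_
  filter_upwards [hev] with n hn
  rw [← e (h.measurable_expIntegral hn.le).aemeasurable]
  have := h.charFun_expIntegral_sub (k := k) hd.continuous hψ le_rfl hn u
  simp only [expIntegral_zero, sub_zero] at this
  exact this.symm

/-- Existence of the improper random integral. -/
lemma exists_tendstoInMeasure (h : IsLevyProcess Y P) (hd : HasDecay k ψ w)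
    (hψ : ∀ (t : ℝ≥0) (u : ℝ), charFun (P.map (Y t)) u = Complex.exp (t * ψ u)) :
    ∃ Z, Measurable Z ∧ TendstoInMeasure P (fun T : ℝ => expIntegral k Y T) atTop Z := by
  refine exists_tendstoInMeasure_of_cauchy (fun T hT => h.measurable_expIntegral hT) ?_
  intro ε hε
  -- The tail at level `r` is controlled by the characteristic function on `|u| ≤ 2/r`, where `K`
  -- bounds `(1+|u|)^3`. A bound `ε/2` there yields `(r/2)(ε/2)(4/r) = ε`.
  set r := ε / 2 with hr
  have hr0 : 0 < r := by positivity
  set K := (1 + 2 * r⁻¹) ^ 3 with hK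
  have hK0 : 0 < K := by positivity
  obtain ⟨T₀, hT₀, htail⟩ := hd.exists_tail_le (η := ε / 2 / K) (by positivity)
  refine ⟨T₀, fun S T hS hST => ?_⟩
  rcases hST.eq_or_lt with rfl | hST
  · simp [not_le.2 hε, hε.le]
  have hS0 := hT₀.trans hS
  have hTm := h.measurable_expIntegral (k := k) (hS0.trans hST.le)
  have hSm := h.measurable_expIntegral (k := k) hS0
  have hXm : Measurable fun ω => expIntegral k Y T ω - expIntegral k Y S ω := hTm.sub hSm
  have := Measure.isProbabilityMeasure_map (μ := P) hXm.aemeasurable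
  have hb : ∀ u, |u| ≤ 2 * r⁻¹ →
      ‖1 - charFun (P.map fun ω => expIntegral k Y T ω - expIntegral k Y S ω) u‖ ≤ ε / 2 := by
    intro u hu
    have h1 := norm_charFun_le_one
      (μ := P.map fun ω => expIntegral k Y T ω - expIntegral k Y S ω) u
    rw [h.charFun_expIntegral_sub hd.continuous hψ hS0 hST, Complex.norm_exp,
      Real.exp_le_one_iff] at h1
    rw [h.charFun_expIntegral_sub hd.continuous hψ hS0 hST, norm_sub_rev]
    refine (norm_exp_sub_one_le_of_re_nonpos h1).trans
      ((hd.norm_intervalIntegral_le hS0 hST.le u).trans ?_)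
    calc (1 + |u|) ^ 3 * ∫ t in S..T, w t * (t ^ k / k !)
        ≤ (1 + |u|) ^ 3 * (ε / 2 / K) := by
          gcongr; exact htail S T hS hST.le
      _ ≤ K * (ε / 2 / K) := by rw [hK]; gcongr
      _ = ε / 2 := by field_simp
  have h2 := measureReal_abs_gt_le_integral_charFun
    (μ := P.map fun ω => expIntegral k Y T ω - expIntegral k Y S ω) hr0
  have h3 := intervalIntegral.norm_integral_le_of_norm_le_const (a := -2 * r⁻¹) (b := 2 * r⁻¹)
    (f := fun u => 1 - charFun (P.map fun ω => expIntegral k Y T ω - expIntegral k Y S ω) u)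
    (C := ε / 2) (fun u hu => hb u (by
      rw [uIoc_of_le (by have := inv_pos.2 hr0; linarith)] at hu
      exact abs_le.2 ⟨by linarith [hu.1], hu.2⟩))
  rw [map_measureReal_apply hXm (measurableSet_lt measurable_const (by fun_prop))] at h2
  have h4 : P.real {ω | ε ≤ |expIntegral k Y T ω - expIntegral k Y S ω|} ≤
      P.real ((fun ω => expIntegral k Y T ω - expIntegral k Y S ω) ⁻¹' {x | r < |x|}) := by
    refine measureReal_mono fun ω hω => ?_
    simp only [mem_preimage, mem_ofPred_eq] at hω ⊢
    linarith
  refine h4.trans (h2.trans ?_)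
  calc 2⁻¹ * r * ‖∫ t in (-2 * r⁻¹)..(2 * r⁻¹), 1 - charFun
        (P.map fun ω => expIntegral k Y T ω - expIntegral k Y S ω) t‖
      ≤ 2⁻¹ * r * (ε / 2 * |2 * r⁻¹ - -2 * r⁻¹|) := by gcongr
    _ = ε := by
      rw [abs_of_pos (by have := inv_pos.2 hr0; linarith)]
      field_simp
      ring

end IsLevyProcess

/-! ### Differentiation of tail moments. -/

lemma setIntegral_Ioi_comp_add {E : Type*} [NormedAddCommGroup E] [NormedSpace ℝ E]
    (f : ℝ → E) (c : ℝ) : ∫ x in Ioi 0, f (c + x) = ∫ x in Ioi c, f x := by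
  have := (measurePreserving_add_left volume c).setIntegral_preimage_emb
    (measurableEmbedding_addLeft c) f (Ioi c)
  rwa [preimage_const_add_Ioi, sub_self] at this

lemma integrableOn_Ioi_comp_add {E : Type*} [NormedAddCommGroup E] {f : ℝ → E} {c : ℝ} :
    IntegrableOn (fun x => f (c + x)) (Ioi 0) ↔ IntegrableOn f (Ioi c) := by
  have := (measurePreserving_add_left volume c).integrableOn_comp_preimage
    (measurableEmbedding_addLeft c) (f := f) (s := Ioi c)
  rwa [preimage_const_add_Ioi, sub_self] at this

/-- `∫_x^∞ H(v) (v-x)^j/j! dv`. -/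
noncomputable def tailMoment (H : ℝ → ℂ) (j : ℕ) (x : ℝ) : ℂ :=
  ∫ r in Ioi (0 : ℝ), (r ^ j / j ! : ℝ) • H (x + r)

lemma tailMoment_eq (H : ℝ → ℂ) (j : ℕ) (x : ℝ) :
    tailMoment H j x = ∫ v in Ioi x, ((v - x) ^ j / j ! : ℝ) • H v := by
  rw [← setIntegral_Ioi_comp_add]
  simp [tailMoment]

lemma hasDerivAt_tailMoment_zero {H : ℝ → ℂ} (hH : Continuous H)
    (hI : ∀ x, IntegrableOn (fun r => (r ^ 0 / 0 ! : ℝ) • H (x + r)) (Ioi 0)) (x : ℝ) :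
    HasDerivAt (tailMoment H 0) (-H x) x := by
  have hI' : ∀ y, IntegrableOn H (Ioi y) := fun y => by
    simpa using integrableOn_Ioi_comp_add.1 (by simpa using hI y)
  have h1 : tailMoment H 0 = fun y => (∫ v in y..x, H v) + ∫ v in Ioi x, H v := by
    funext y
    rw [intervalIntegral.integral_interval_add_Ioi (hI' y) (hI' x), tailMoment_eq]
    simp
  rw [h1]
  exact (intervalIntegral.integral_hasDerivAt_left (hH.intervalIntegrable _ _)
    hH.stronglyMeasurable.stronglyMeasurableAtFilter hH.continuousAt).add_const _

/-- The truncated power extends the kernel by zero, and this Lipschitz constant, independent of `y`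
and `z`, is the majorant for differentiating under the integral. -/
lemma abs_max_pow_sub_le (j : ℕ) {v y z a : ℝ} (ha : a ≤ v) (hy : a ≤ y) (hz : a ≤ z) :
    |max (v - y) 0 ^ (j + 1) / ((j + 1)! : ℝ) - max (v - z) 0 ^ (j + 1) / ((j + 1)! : ℝ)| ≤
      (v - a) ^ j / j ! * |y - z| := by
  have hfac : (0 : ℝ) < (j + 1)! := by positivity
  have h1 := abs_pow_sub_pow_le (max (v - y) 0) (max (v - z) 0) (j + 1)
  have h2 : max |max (v - y) 0| |max (v - z) 0| ≤ v - a := by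
    rw [abs_of_nonneg (le_max_right _ _), abs_of_nonneg (le_max_right _ _)]
    exact max_le (max_le (by linarith) (by linarith)) (max_le (by linarith) (by linarith))
  have h3 : |max (v - y) 0 - max (v - z) 0| ≤ |y - z| := by
    have := abs_max_sub_max_le_abs (v - y) (v - z) 0
    rwa [show v - y - (v - z) = -(y - z) by ring, abs_neg] at this
  have h0 : 0 ≤ max |max (v - y) 0| |max (v - z) 0| := le_max_of_le_left (abs_nonneg _)
  rw [← sub_div, abs_div, abs_of_pos hfac, div_le_iff₀ hfac]
  calc |max (v - y) 0 ^ (j + 1) - max (v - z) 0 ^ (j + 1)|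
      ≤ |y - z| * (j + 1 : ℕ) * (v - a) ^ j := by
        refine h1.trans ?_
        rw [Nat.add_sub_cancel]
        gcongr
    _ = (v - a) ^ j / j ! * |y - z| * (j + 1)! := by
        rw [Nat.factorial_succ]
        push_cast
        field_simp

lemma hasDerivAt_max_sub_pow (j : ℕ) {v x : ℝ} (hv : v ≠ x) :
    HasDerivAt (fun y => max (v - y) 0 ^ (j + 1) / ((j + 1)! : ℝ))
      (-(if x < v then (v - x) ^ j / (j ! : ℝ) else 0)) x := by
  rcases hv.lt_or_gt with h | h
  · rw [if_neg (not_lt.2 h.le), neg_zero]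
    refine (hasDerivAt_const x (0 : ℝ)).congr_of_eventuallyEq ?_
    filter_upwards [lt_mem_nhds h] with y hy
    rw [max_eq_right (by linarith), zero_pow j.succ_ne_zero, zero_div]
  · rw [if_pos h]
    have h1 : HasDerivAt (fun y => (v - y) ^ (j + 1) / ((j + 1)! : ℝ))
        (((j + 1 : ℕ) : ℝ) * (v - x) ^ j * (-1) / ((j + 1)! : ℝ)) x := by
      simpa using (((hasDerivAt_id x).const_sub v).pow (j + 1)).div_const ((j + 1)! : ℝ)
    have h2 : ((j + 1 : ℕ) : ℝ) * (v - x) ^ j * (-1) / ((j + 1)! : ℝ) = -((v - x) ^ j / j !) := by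
      rw [Nat.factorial_succ]
      push_cast
      field_simp
    rw [h2] at h1
    refine h1.congr_of_eventuallyEq ?_
    filter_upwards [gt_mem_nhds h] with y hy
    rw [max_eq_left (by linarith)]

lemma hasDerivAt_tailMoment_succ {H : ℝ → ℂ} (hH : Continuous H) {j : ℕ}
    (hI : ∀ x, IntegrableOn (fun r => (r ^ j / j ! : ℝ) • H (x + r)) (Ioi 0))
    (hI' : ∀ x, IntegrableOn (fun r => (r ^ (j + 1) / (j + 1)! : ℝ) • H (x + r)) (Ioi 0)) (x : ℝ) :
    HasDerivAt (tailMoment H (j + 1)) (-tailMoment H j x) x := by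
  set F : ℝ → ℝ → ℂ := fun y v => (max (v - y) 0 ^ (j + 1) / (j + 1)! : ℝ) • H v with hF
  set F' : ℝ → ℂ := fun v => (-(if x < v then (v - x) ^ j / (j ! : ℝ) else 0)) • H v with hF'
  -- A fixed lower limit below `x` removes the moving end point. The kernel can fail to be
  -- differentiable only at `v = x`, a null set, so the Lipschitz form of differentiation under the
  -- integral applies.
  set a := x - 1 with ha
  have hxa : a < x := by linarith
  have hFzero : ∀ y v, v ≤ y → F y v = 0 := by
    intro y v hvy
    simp only [hF]
    rw [max_eq_right (by linarith), zero_pow j.succ_ne_zero, zero_div, zero_smul]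
  have hFeq : ∀ y v, y < v → F y v = ((v - y) ^ (j + 1) / (j + 1)! : ℝ) • H v := by
    intro y v hvy
    simp only [hF]
    rw [max_eq_left (by linarith)]
  have hJ : ∀ y, a < y → tailMoment H (j + 1) y = ∫ v in Ioi a, F y v := by
    intro y hy
    rw [tailMoment_eq, setIntegral_eq_of_subset_of_forall_sdiff_eq_zero measurableSet_Ioi
      (Ioi_subset_Ioi hy.le) (f := F y) fun v hv => hFzero y v (not_lt.1 hv.2)]
    exact (setIntegral_congr_fun measurableSet_Ioi fun v hv => (hFeq y v hv)).symm
  have hF'eq : ∫ v in Ioi a, F' v = -tailMoment H j x := by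
    rw [tailMoment_eq, ← integral_neg, setIntegral_eq_of_subset_of_forall_sdiff_eq_zero
      measurableSet_Ioi (Ioi_subset_Ioi hxa.le) (f := F')]
    · refine setIntegral_congr_fun measurableSet_Ioi fun v hv => ?_
      simp only [hF', if_pos (mem_Ioi.1 hv), neg_smul]
    · intro v hv
      have hv' : ¬x < v := hv.2
      simp only [hF', if_neg hv', neg_zero, zero_smul]
  have hbi : IntegrableOn (fun v => (v - a) ^ j / j ! * ‖H v‖) (Ioi a) := by
    refine integrableOn_Ioi_comp_add.1 ((hI a).norm.congr ?_)
    refine (ae_restrict_iff' measurableSet_Ioi).2 (Eventually.of_forall fun r hr => ?_)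
    have hr' : (0 : ℝ) ≤ r := le_of_lt hr
    simp only [norm_smul, add_sub_cancel_left]
    rw [Real.norm_of_nonneg (by positivity)]
  have hFx : IntegrableOn (F x) (Ioi a) := by
    have h1 : IntegrableOn (F x) (Ioi x) := by
      refine integrableOn_Ioi_comp_add.1 ((hI' x).congr ?_)
      refine (ae_restrict_iff' measurableSet_Ioi).2 (Eventually.of_forall fun r hr => ?_)
      simp only
      rw [hFeq _ _ (by simpa using hr), add_sub_cancel_left]
    exact h1.of_forall_sdiff_eq_zero measurableSet_Ioi fun v hv => hFzero x v (not_lt.1 hv.2)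
  have hm : Measurable fun v => -(if x < v then (v - x) ^ j / (j ! : ℝ) else 0) :=
    (Measurable.ite measurableSet_Ioi (by fun_prop) measurable_const).neg
  have key := hasDerivAt_integral_of_dominated_loc_of_lip (μ := volume.restrict (Ioi a))
    (F := F) (F' := F') (x₀ := x) (s := Ioi a) (bound := fun v => (v - a) ^ j / j ! * ‖H v‖)
    (Ioi_mem_nhds hxa)
    (Eventually.of_forall fun y => Continuous.aestronglyMeasurable (by fun_prop)) hFx
    (hm.aestronglyMeasurable.smul hH.aestronglyMeasurable)
    ((ae_restrict_iff' measurableSet_Ioi).2 (Eventually.of_forall fun v hv => by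
      refine LipschitzOnWith.of_dist_le_mul fun y hy z hz => ?_
      have hv' : (0 : ℝ) ≤ v - a := sub_nonneg.2 (le_of_lt hv)
      simp only [hF]
      rw [dist_eq_norm, ← sub_smul, norm_smul, Real.coe_nnabs, abs_of_nonneg (by positivity),
        Real.dist_eq, Real.norm_eq_abs]
      have := mul_le_mul_of_nonneg_right
        (abs_max_pow_sub_le j (le_of_lt hv) (le_of_lt hy) (le_of_lt hz)) (norm_nonneg (H v))
      linarith))
    hbi (by
      have hne : ∀ᵐ v ∂(volume.restrict (Ioi a)), v ≠ x :=
        ae_restrict_of_ae (by simp [ae_iff])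
      filter_upwards [hne] with v hv
      exact (hasDerivAt_max_sub_pow j hv).smul_const (H v))
  rw [hF'eq] at key
  refine key.2.congr_of_eventuallyEq ?_
  filter_upwards [Ioi_mem_nhds hxa] with y hy using hJ y hy

/-! ### The Laplace transform in logarithmic scale. -/

/-- `∫_0^∞ g(-u) e^{-tu} du`. -/
noncomputable def negLaplace (g : ℝ → ℂ) (t : ℝ) : ℂ :=
  ∫ u in Ioi (0 : ℝ), g (-u) * (Real.exp (-(t * u)) : ℂ)

lemma integrableOn_one_add_pow_mul_exp {t : ℝ} (ht : 0 < t) :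
    IntegrableOn (fun u : ℝ => (1 + u) ^ 3 * Real.exp (-(t * u))) (Ioi 0) := by
  have h : ∀ j : ℕ, IntegrableOn (fun u : ℝ => u ^ j * Real.exp (-(t * u))) (Ioi 0) := by
    intro j
    have := integrableOn_rpow_mul_exp_neg_mul_rpow (s := (j : ℝ)) (p := 1) (b := t)
      (by linarith [Nat.cast_nonneg (α := ℝ) j]) one_pos ht
    refine this.congr_fun (fun u hu => ?_) measurableSet_Ioi
    simp only [Real.rpow_natCast, Real.rpow_one, neg_mul]
  refine ((((h 0).add ((h 1).const_mul 3)).add ((h 2).const_mul 3)).add (h 3)).congr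
    (Eventually.of_forall fun u => ?_)
  simp only [Pi.add_apply]
  ring

lemma norm_mul_exp_le {g : ℝ → ℂ} {M : ℝ} (hM : ∀ u, ‖g u‖ ≤ (1 + |u|) ^ 3 * M) (t : ℝ) {u : ℝ}
    (hu : 0 < u) :
    ‖g (-u) * (Real.exp (-(t * u)) : ℂ)‖ ≤ M * ((1 + u) ^ 3 * Real.exp (-(t * u))) := by
  rw [norm_mul, Complex.norm_real, Real.norm_eq_abs, Real.abs_exp]
  have := hM (-u)
  rw [abs_neg, abs_of_pos hu] at this
  calc ‖g (-u)‖ * Real.exp (-(t * u)) ≤ ((1 + u) ^ 3 * M) * Real.exp (-(t * u)) := by gcongr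
    _ = _ := by ring

lemma integrableOn_negLaplace {g : ℝ → ℂ} (hg : Continuous g) {M : ℝ}
    (hM : ∀ u, ‖g u‖ ≤ (1 + |u|) ^ 3 * M) {t : ℝ} (ht : 0 < t) :
    IntegrableOn (fun u : ℝ => g (-u) * (Real.exp (-(t * u)) : ℂ)) (Ioi 0) :=
  Integrable.mono' ((integrableOn_one_add_pow_mul_exp ht).const_mul M)
    (Continuous.aestronglyMeasurable (by fun_prop))
    ((ae_restrict_iff' measurableSet_Ioi).2 (Eventually.of_forall fun _ hu =>
      norm_mul_exp_le hM t hu))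

lemma continuousAt_negLaplace {g : ℝ → ℂ} (hg : Continuous g) {M : ℝ}
    (hM : ∀ u, ‖g u‖ ≤ (1 + |u|) ^ 3 * M) {t : ℝ} (ht : 0 < t) :
    ContinuousAt (negLaplace g) t := by
  have hM0 : 0 ≤ M := by simpa using (norm_nonneg _).trans (hM 0)
  refine continuousAt_of_dominated
    (bound := fun u => M * ((1 + u) ^ 3 * Real.exp (-(t / 2 * u))))
    (Eventually.of_forall fun s => Continuous.aestronglyMeasurable (by fun_prop)) ?_
    ((integrableOn_one_add_pow_mul_exp (half_pos ht)).const_mul M)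
    (Eventually.of_forall fun u => by fun_prop)
  filter_upwards [lt_mem_nhds (half_lt_self ht)] with s hs
  refine (ae_restrict_iff' measurableSet_Ioi).2 (Eventually.of_forall fun u hu => ?_)
  have hu' : (0 : ℝ) < u := hu
  refine (norm_mul_exp_le hM s hu').trans ?_
  gcongr

/-- `x ↦ t ∫_0^∞ g(-u) e^{-tu} du` in the variable `x = log t`. -/
noncomputable def logLaplace (g : ℝ → ℂ) (x : ℝ) : ℂ :=
  (Real.exp x : ℂ) * negLaplace g (Real.exp x)

lemma continuous_logLaplace {g : ℝ → ℂ} (hg : Continuous g) {M : ℝ}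
    (hM : ∀ u, ‖g u‖ ≤ (1 + |u|) ^ 3 * M) : Continuous (logLaplace g) := by
  refine Continuous.mul (by fun_prop) (continuous_iff_continuousAt.2 fun x => ?_)
  exact ContinuousAt.comp (f := Real.exp) (continuousAt_negLaplace hg hM (Real.exp_pos x))
    Real.continuous_exp.continuousAt

/-- The substitution `u ↦ e^{-r}u` turns the translation by `r` into a dilation of the argument of
`g`; the prefactor `e^x` absorbs the Jacobian. -/
lemma logLaplace_add (g : ℝ → ℂ) (x r : ℝ) :
    logLaplace g (x + r) = (Real.exp x : ℂ) *
      ∫ u in Ioi (0 : ℝ), g (Real.exp (-r) * -u) * (Real.exp (-(Real.exp x * u)) : ℂ) := by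
  have h1 := integral_comp_mul_left_Ioi
    (fun u => g (-u) * (Real.exp (-(Real.exp (x + r) * u)) : ℂ)) 0 (Real.exp_pos (-r))
  rw [mul_zero, Real.exp_neg r, inv_inv] at h1
  rw [logLaplace, negLaplace, Real.exp_add, Complex.ofReal_mul, mul_assoc]
  congr 1
  rw [← Complex.real_smul, ← Real.exp_add, ← h1]
  refine setIntegral_congr_fun measurableSet_Ioi fun u _ => ?_
  simp only [Real.exp_neg r, mul_neg]
  congr 4
  rw [Real.exp_add]
  field_simp

namespace HasDecay

variable {k j : ℕ} {ψ : ℝ → ℂ} {w : ℝ → ℝ}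

lemma norm_le (h : HasDecay k ψ w) (u : ℝ) : ‖ψ u‖ ≤ (1 + |u|) ^ 3 * w 0 := by
  simpa using h.bound 0 u le_rfl

/-- Through the dilation, the decay of `ψ(e^{-r}u)` in `r` becomes decay of the transform along
translations. -/
lemma norm_logLaplace_add_le (h : HasDecay k ψ w) (x : ℝ) {r : ℝ} (hr : 0 ≤ r) :
    ‖logLaplace ψ (x + r)‖ ≤ Real.exp x *
      (∫ u in Ioi (0 : ℝ), (1 + u) ^ 3 * Real.exp (-(Real.exp x * u))) * w r := by
  rw [logLaplace_add, norm_mul, Complex.norm_real, Real.norm_eq_abs, Real.abs_exp, mul_assoc]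
  refine mul_le_mul_of_nonneg_left ?_ (Real.exp_pos x).le
  rw [← integral_mul_const]
  refine norm_integral_le_of_norm_le
    ((integrableOn_one_add_pow_mul_exp (Real.exp_pos x)).mul_const _)
    ((ae_restrict_iff' measurableSet_Ioi).2 (Eventually.of_forall fun u hu => ?_))
  have := norm_mul_exp_le (g := fun u => ψ (Real.exp (-r) * u)) (fun u => h.bound r u hr)
    (Real.exp x) hu
  linarith

lemma integrableOn_logLaplace (h : HasDecay k ψ w) (hj : j ≤ k) (x : ℝ) :
    IntegrableOn (fun r => (r ^ j / j ! : ℝ) • logLaplace ψ (x + r)) (Ioi 0) := by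
  have hc := continuous_logLaplace h.continuous h.norm_le
  refine Integrable.mono' ((h.integrable j hj).const_mul (Real.exp x *
      (∫ u in Ioi (0 : ℝ), (1 + u) ^ 3 * Real.exp (-(Real.exp x * u)))))
    (Continuous.aestronglyMeasurable (by fun_prop))
    ((ae_restrict_iff' measurableSet_Ioi).2 (Eventually.of_forall fun r hr => ?_))
  have hr' : (0 : ℝ) ≤ r := le_of_lt hr
  have h0 : 0 ≤ r ^ j / (j ! : ℝ) := by positivity
  rw [norm_smul, Real.norm_of_nonneg h0]
  have := mul_le_mul_of_nonneg_left (h.norm_logLaplace_add_le x hr') h0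
  linarith

/-- The Laplace transform of `iteratedExponent ψ j` as a tail moment. -/
lemma logLaplace_iteratedExponent (h : HasDecay k ψ w) (hj : j ≤ k) (x : ℝ) :
    logLaplace (iteratedExponent ψ j) x = tailMoment (logLaplace ψ) j x := by
  have hc := h.continuous
  have hswap : ∫ u in Ioi (0 : ℝ), ∫ r in Ioi (0 : ℝ),
      (r ^ j / j ! : ℝ) • (ψ (Real.exp (-r) * -u) * (Real.exp (-(Real.exp x * u)) : ℂ))
      = ∫ r in Ioi (0 : ℝ), ∫ u in Ioi (0 : ℝ),
      (r ^ j / j ! : ℝ) • (ψ (Real.exp (-r) * -u) * (Real.exp (-(Real.exp x * u)) : ℂ)) := by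
    refine integral_integral_swap ?_
    refine Integrable.mono' ((integrableOn_one_add_pow_mul_exp (Real.exp_pos x)).mul_prod
      (h.integrable j hj)) (Continuous.aestronglyMeasurable (by
        unfold Function.uncurry; fun_prop)) ?_
    rw [Measure.prod_restrict]
    refine (ae_restrict_iff' (measurableSet_Ioi.prod measurableSet_Ioi)).2
      (Eventually.of_forall fun p hp => ?_)
    have hp1 : (0 : ℝ) < p.1 := hp.1
    have hp2 : (0 : ℝ) < p.2 := hp.2
    have h0 : 0 ≤ p.2 ^ j / (j ! : ℝ) := by positivity
    simp only [Function.uncurry]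
    rw [norm_smul, Real.norm_of_nonneg h0]
    have := mul_le_mul_of_nonneg_left (norm_mul_exp_le (g := fun u => ψ (Real.exp (-p.2) * u))
      (fun u => h.bound p.2 u hp2.le) (Real.exp x) hp1) h0
    linarith
  have hl : negLaplace (iteratedExponent ψ j) (Real.exp x) = ∫ u in Ioi (0 : ℝ),
      ∫ r in Ioi (0 : ℝ), (r ^ j / j ! : ℝ) •
        (ψ (Real.exp (-r) * -u) * (Real.exp (-(Real.exp x * u)) : ℂ)) := by
    refine setIntegral_congr_fun measurableSet_Ioi fun u _ => ?_
    simp only [iteratedExponent]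
    rw [← integral_mul_const]
    simp only [smul_mul_assoc]
  rw [logLaplace, hl, hswap, tailMoment, ← integral_const_mul]
  refine setIntegral_congr_fun measurableSet_Ioi fun r _ => ?_
  rw [integral_smul, logLaplace_add, mul_smul_comm]

lemma hasDerivAt_logLaplace_succ (h : HasDecay k ψ w) (hj : j + 1 ≤ k) (x : ℝ) :
    HasDerivAt (logLaplace (iteratedExponent ψ (j + 1)))
      (-logLaplace (iteratedExponent ψ j) x) x := by
  rw [h.logLaplace_iteratedExponent (by omega),
    show logLaplace (iteratedExponent ψ (j + 1)) = tailMoment (logLaplace ψ) (j + 1) from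
      funext (h.logLaplace_iteratedExponent hj)]
  exact hasDerivAt_tailMoment_succ (continuous_logLaplace h.continuous h.norm_le)
    (h.integrableOn_logLaplace (by omega)) (h.integrableOn_logLaplace hj) x

lemma hasDerivAt_logLaplace_zero (h : HasDecay k ψ w) (x : ℝ) :
    HasDerivAt (logLaplace (iteratedExponent ψ 0)) (-logLaplace ψ x) x := by
  rw [show logLaplace (iteratedExponent ψ 0) = tailMoment (logLaplace ψ) 0 from
      funext (h.logLaplace_iteratedExponent (Nat.zero_le k))]
  exact hasDerivAt_tailMoment_zero (continuous_logLaplace h.continuous h.norm_le)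
    (h.integrableOn_logLaplace (Nat.zero_le k)) x

end HasDecay

/-- If `V(t) = i t² ∫_0^∞ f(-u) e^{-tu} du` and `f` has logarithmic derivative `g`, then
`D V(t) = i t² ∫_0^∞ g(-u) e^{-tu} du`. -/
lemma hasDerivAt_and_opD_eq {f g V : ℝ → ℂ}
    (hV : ∀ t : ℝ, 0 < t → V t = Complex.I * (t : ℂ) ^ 2 * negLaplace f t)
    (hd : ∀ x, HasDerivAt (logLaplace f) (-logLaplace g x) x) {t : ℝ} (ht : 0 < t) :
    DifferentiableAt ℝ V t ∧ opD V t = Complex.I * (t : ℂ) ^ 2 * negLaplace g t := by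
  have hlog : ∀ (f : ℝ → ℂ) (s : ℝ), 0 < s → logLaplace f (Real.log s) = s * negLaplace f s := by
    intro f s hs
    rw [logLaplace, Real.exp_log hs]
  -- One factor `t` goes into `logLaplace`, leaving `V = i t h(log t)`; then `V - tV' = -i t h'(log
  -- t)`.
  have hV' : V =ᶠ[𝓝 t] fun s => Complex.I * (s : ℂ) * logLaplace f (Real.log s) := by
    filter_upwards [lt_mem_nhds ht] with s hs
    rw [hV s hs, hlog f s hs]
    ring
  have h1 := (hd (Real.log t)).scomp t (Real.hasDerivAt_log ht.ne')
  have h2 := (((Complex.ofRealCLM.hasDerivAt (x := t)).const_mul Complex.I).mul h1).congr_of_eventuallyEq hV'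
  refine ⟨h2.differentiableAt, ?_⟩
  have htC : (t : ℂ) ≠ 0 := Complex.ofReal_ne_zero.2 ht.ne'
  rw [opD, h2.deriv, hV t ht]
  simp only [Function.comp_apply, hlog _ t ht, Complex.ofRealCLM_apply, Complex.real_smul]
  push_cast
  field_simp
  ring

/-! ### Free infinite divisibility of the transform of a Lévy exponent. -/

/-- The kernel `x ↦ (1 + itx)/(it - x)` of free-infinitely divisible Voiculescu transforms. -/
noncomputable def freeKernel (t x : ℝ) : ℂ := (1 + Complex.I * t * x) / (Complex.I * t - x)

lemma I_mul_sub_ne_zero {t : ℝ} (ht : 0 < t) (x : ℝ) : Complex.I * t - x ≠ 0 := by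
  intro h
  have := congrArg Complex.im h
  simp at this
  exact ht.ne' this

lemma add_I_mul_ne_zero {t : ℝ} (ht : 0 < t) (x : ℝ) : (t : ℂ) + x * Complex.I ≠ 0 := by
  intro h
  have := congrArg Complex.re h
  simp at this
  exact ht.ne' this

lemma continuous_freeKernel {t : ℝ} (ht : 0 < t) : Continuous (freeKernel t) :=
  Continuous.div (by fun_prop) (by fun_prop) (I_mul_sub_ne_zero ht)

lemma norm_freeKernel_le {t : ℝ} (ht : 0 < t) (x : ℝ) : ‖freeKernel t x‖ ≤ 1 / t + t := by
  have h1 : t ≤ ‖Complex.I * t - x‖ := by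
    have := Complex.abs_im_le_norm (Complex.I * t - x)
    simp at this
    exact (le_abs_self t).trans this
  have h2 : |x| ≤ ‖Complex.I * t - x‖ := by
    have := Complex.abs_re_le_norm (Complex.I * t - x)
    simpa using this
  have h3 : ‖1 + Complex.I * t * x‖ ≤ 1 + t * |x| := by
    refine (norm_add_le _ _).trans ?_
    simp [abs_of_pos ht]
  rw [freeKernel, norm_div, div_le_iff₀ (ht.trans_le h1)]
  refine h3.trans ?_
  rw [add_mul]
  have h4 : 1 ≤ 1 / t * ‖Complex.I * t - x‖ := by
    rw [one_div, ← div_eq_inv_mul, one_le_div ht]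
    exact h1
  have h5 := mul_le_mul_of_nonneg_left h2 ht.le
  linarith

lemma integrable_freeKernel {t : ℝ} (ht : 0 < t) (m : Measure ℝ) [IsFiniteMeasure m] :
    Integrable (freeKernel t) m :=
  Integrable.of_bound (continuous_freeKernel ht).aestronglyMeasurable _
    (Eventually.of_forall (norm_freeKernel_le ht))

lemma freeKernel_im {t : ℝ} (ht : 0 < t) (x : ℝ) :
    (freeKernel t x).im = -(t * ((1 + x ^ 2) / (t ^ 2 + x ^ 2))) := by
  have h : t ^ 2 + x ^ 2 ≠ 0 := by positivity
  rw [freeKernel, Complex.div_im]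
  simp [Complex.normSq_apply]
  have h' : x * x + t * t ≠ 0 := fun h0 => h (by linarith)
  field_simp
  ring

lemma freeKernel_one (x : ℝ) : freeKernel 1 x = -Complex.I := by
  have := I_mul_sub_ne_zero one_pos x
  rw [freeKernel, div_eq_iff this]
  push_cast
  linear_combination Complex.I_sq

/-- The real constant `a` drops out of the imaginary part, and `-Im` of the kernel is nonnegative,
and at least `t/2` where `|x| ≥ t`. -/
lemma measureReal_le_of_freeKernel {t : ℝ} (ht : 1 ≤ t) (a : ℝ) (m : Measure ℝ)
    [IsFiniteMeasure m] :
    m.real {x | t ≤ |x|} ≤ 2 * (‖(a : ℂ) + ∫ x, freeKernel t x ∂m‖ / t) := by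
  have ht0 : 0 < t := by linarith
  have hi := integrable_freeKernel ht0 m
  have him : (∫ x, freeKernel t x ∂m).im = ∫ x, (freeKernel t x).im ∂m := by
    have := integral_im hi
    simpa using this.symm
  have hS : MeasurableSet {x : ℝ | t ≤ |x|} := measurableSet_le measurable_const (by fun_prop)
  have h1 : m.real {x | t ≤ |x|} * (t / 2) ≤ ∫ x, -(freeKernel t x).im ∂m := by
    rw [← smul_eq_mul, ← integral_indicator_const (t / 2) hS]
    refine integral_mono ((integrable_const _).indicator hS) hi.im.neg fun x => ?_
    rw [freeKernel_im ht0, neg_neg]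
    by_cases hx : t ≤ |x|
    · rw [indicator_of_mem (show x ∈ {x : ℝ | t ≤ |x|} from hx), div_eq_mul_one_div t 2]
      refine mul_le_mul_of_nonneg_left ?_ ht0.le
      rw [div_le_div_iff₀ two_pos (by positivity)]
      have : t ^ 2 ≤ x ^ 2 := by rw [← sq_abs x]; gcongr
      linarith
    · rw [indicator_of_notMem (show x ∉ {x : ℝ | t ≤ |x|} from hx)]
      positivity
  rw [integral_neg, ← him] at h1
  have h2 := Complex.abs_im_le_norm ((a : ℂ) + ∫ x, freeKernel t x ∂m)
  rw [Complex.add_im, Complex.ofReal_im, zero_add] at h2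
  have h3 := (neg_le_abs _).trans h2
  rw [← mul_div_assoc, le_div_iff₀ ht0]
  linarith

/-- The measure `N x²/(1+x²) ν(dx)`. -/
noncomputable def scaledMeasure (N : ℕ) (ν : Measure ℝ) : Measure ℝ :=
  ν.withDensity fun x => ((N * (x ^ 2 / (1 + x ^ 2))).toNNReal : ℝ≥0)

lemma sq_div_one_add_sq_le (x : ℝ) : x ^ 2 / (1 + x ^ 2) ≤ 1 := by
  rw [div_le_one (by positivity)]
  linarith

instance (N : ℕ) (ν : Measure ℝ) [IsFiniteMeasure ν] : IsFiniteMeasure (scaledMeasure N ν) := by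
  refine isFiniteMeasure_withDensity (ne_of_lt ?_)
  refine lt_of_le_of_lt (lintegral_mono (g := fun _ => ((N : ℝ≥0) : ENNReal)) fun x => ?_) ?_
  · rw [ENNReal.coe_le_coe, Real.toNNReal_le_iff_le_coe]
    simpa using mul_le_mul_of_nonneg_left (sq_div_one_add_sq_le x) (Nat.cast_nonneg (α := ℝ) N)
  · rw [lintegral_const]
    exact ENNReal.mul_lt_top ENNReal.coe_lt_top (measure_lt_top _ _)

lemma negLaplace_charFun_sub_one (ν : Measure ℝ) [IsProbabilityMeasure ν] {t : ℝ} (ht : 0 < t) :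
    negLaplace (fun u => charFun ν u - 1) t =
      ∫ x : ℝ, (1 / ((t : ℂ) + x * Complex.I) - 1 / t) ∂ν := by
  have hexp : ∀ x : ℝ, ∀ u : ℝ, ‖Complex.exp ((-u : ℝ) * x * Complex.I)‖ = 1 := by
    intro x u
    rw [← Complex.ofReal_mul, Complex.norm_exp_ofReal_mul_I]
  have hi : ∀ u : ℝ, Integrable (fun x : ℝ => Complex.exp ((-u : ℝ) * x * Complex.I)) ν :=
    fun u => Integrable.of_bound (C := 1) (by fun_prop)
      (Eventually.of_forall fun x => (hexp x u).le)
  have hint : IntegrableOn (fun u : ℝ => 2 * Real.exp (-(t * u))) (Ioi 0) := by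
    have := (exp_neg_integrableOn_Ioi 0 ht).const_mul 2
    simpa only [neg_mul, IntegrableOn] using this
  calc negLaplace (fun u => charFun ν u - 1) t
      = ∫ u in Ioi (0 : ℝ), ∫ x : ℝ, (Complex.exp ((-u : ℝ) * x * Complex.I) - 1) *
          (Real.exp (-(t * u)) : ℂ) ∂ν := by
        refine setIntegral_congr_fun measurableSet_Ioi fun u _ => ?_
        simp only
        rw [integral_mul_const, integral_sub (hi u) (integrable_const _), charFun_apply_real]
        simp
    _ = ∫ x : ℝ, (∫ u in Ioi (0 : ℝ), (Complex.exp ((-u : ℝ) * x * Complex.I) - 1) *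
          (Real.exp (-(t * u)) : ℂ)) ∂ν := by
        refine integral_integral_swap ?_
        refine Integrable.mono' (hint.mul_prod (integrable_const (1 : ℝ)))
          (Continuous.aestronglyMeasurable (by unfold Function.uncurry; fun_prop))
          (Eventually.of_forall fun p => ?_)
        simp only [Function.uncurry]
        rw [norm_mul, Complex.norm_real, Real.norm_eq_abs, Real.abs_exp, mul_one]
        refine mul_le_mul_of_nonneg_right ((norm_sub_le _ _).trans ?_) (Real.exp_pos _).le
        rw [hexp, norm_one]
        norm_num
    _ = _ := by
        refine integral_congr_ae (Eventually.of_forall fun x => ?_)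
        have ha : ∀ y : ℝ, (-((t : ℂ) + y * Complex.I)).re < 0 := by intro y; simpa using ht
        have h1 := integral_exp_mul_complex_Ioi (ha x) 0
        have h2 := integral_exp_mul_complex_Ioi (ha 0) 0
        have i1 := integrableOn_exp_mul_complex_Ioi (ha x) 0
        have i2 := integrableOn_exp_mul_complex_Ioi (ha 0) 0
        simp only
        have h3 : ∀ u : ℝ, (Complex.exp ((-u : ℝ) * x * Complex.I) - 1) *
            (Real.exp (-(t * u)) : ℂ) = Complex.exp (-((t : ℂ) + x * Complex.I) * u) -
              Complex.exp (-((t : ℂ) + (0 : ℝ) * Complex.I) * u) := by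
          intro u
          rw [sub_mul, one_mul, Complex.ofReal_exp, ← Complex.exp_add]
          push_cast
          congr 2 <;> ring
        simp only [h3]
        rw [integral_sub i1 i2, h1, h2]
        simp only [Complex.ofReal_zero, mul_zero, Complex.exp_zero, zero_mul, add_zero,
          neg_div_neg_eq]

/-- The compound Poisson case. It rests on `it²(1/(t+ix) - 1/t) = tx/(t+ix)`, which equals
`x/(1+x²)` plus `x²/(1+x²)` times the kernel. -/
lemma negLaplace_eq_freeKernel (ν : Measure ℝ) [IsProbabilityMeasure ν] (N : ℕ) {t : ℝ}
    (ht : 0 < t) :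
    Complex.I * (t : ℂ) ^ 2 * negLaplace (fun u => N * (charFun ν u - 1)) t =
      ((N * ∫ x, x / (1 + x ^ 2) ∂ν : ℝ) : ℂ) + ∫ x, freeKernel t x ∂(scaledMeasure N ν) := by
  have h1 : negLaplace (fun u => N * (charFun ν u - 1)) t =
      N * negLaplace (fun u => charFun ν u - 1) t := by
    simp only [negLaplace, mul_assoc]
    rw [integral_const_mul]
  have hx : Integrable (fun x : ℝ => x / (1 + x ^ 2)) ν := by
    refine Integrable.of_bound (C := 1) (Measurable.aestronglyMeasurable (by fun_prop))
      (Eventually.of_forall fun x => ?_)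
    rw [Real.norm_eq_abs, abs_div, abs_of_pos (by positivity : (0 : ℝ) < 1 + x ^ 2),
      div_le_one (by positivity), ← sq_abs]
    nlinarith [sq_nonneg (|x| - 1)]
  have hk : Integrable (fun x : ℝ => ((x ^ 2 / (1 + x ^ 2) : ℝ) : ℂ) * freeKernel t x) ν := by
    refine (integrable_freeKernel ht ν).bdd_mul (c := 1)
      (Measurable.aestronglyMeasurable (by fun_prop)) (Eventually.of_forall fun x => ?_)
    rw [Complex.norm_real, Real.norm_of_nonneg (by positivity)]
    exact sq_div_one_add_sq_le x
  have h2 : ∀ x : ℝ, Complex.I * (t : ℂ) ^ 2 * (1 / ((t : ℂ) + x * Complex.I) - 1 / t) =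
      ((x / (1 + x ^ 2) : ℝ) : ℂ) + ((x ^ 2 / (1 + x ^ 2) : ℝ) : ℂ) * freeKernel t x := by
    intro x
    have e1 := I_mul_sub_ne_zero ht x
    have e2 := add_I_mul_ne_zero ht x
    have e3 : (t : ℂ) ≠ 0 := Complex.ofReal_ne_zero.2 ht.ne'
    have e4 : (1 : ℂ) + (x : ℂ) ^ 2 ≠ 0 := by
      have : (1 + x ^ 2 : ℝ) ≠ 0 := by positivity
      exact_mod_cast Complex.ofReal_ne_zero.2 this
    have e5 : Complex.I * t - x = Complex.I * ((t : ℂ) + x * Complex.I) := by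
      linear_combination (-(x : ℂ)) * Complex.I_sq
    have e6 : 1 / ((t : ℂ) + x * Complex.I) - 1 / t = -(x * Complex.I) / (t * (t + x * Complex.I)) := by
      field_simp
      ring
    have e7 : Complex.I * (t : ℂ) ^ 2 * (-(x * Complex.I) / (t * (t + x * Complex.I))) =
        t * x / (t + x * Complex.I) := by
      rw [← mul_div_assoc, div_eq_div_iff (mul_ne_zero e3 e2) e2]
      linear_combination (-(t : ℂ) ^ 2 * x * (t + x * Complex.I)) * Complex.I_sq
    rw [e6, e7, freeKernel]
    push_cast
    rw [div_mul_div_comm, div_add_div _ _ e4 (mul_ne_zero e4 e1), div_eq_div_iff e2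
      (mul_ne_zero e4 (mul_ne_zero e4 e1)), e5]
    linear_combination
      (-(t * x ^ 2 + t * x ^ 4 + x ^ 3 * Complex.I + x ^ 5 * Complex.I : ℂ)) * Complex.I_sq
  rw [h1, negLaplace_charFun_sub_one ν ht, scaledMeasure,
    integral_withDensity_eq_integral_smul (by fun_prop)]
  have h3 : ∀ x : ℝ, ((N * (x ^ 2 / (1 + x ^ 2))).toNNReal : ℝ≥0) • freeKernel t x =
      N * (((x ^ 2 / (1 + x ^ 2) : ℝ) : ℂ) * freeKernel t x) := by
    intro x
    rw [NNReal.smul_def, Real.coe_toNNReal _ (by positivity), Complex.real_smul]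
    push_cast
    ring
  simp only [h3]
  rw [integral_const_mul, mul_left_comm, ← integral_const_mul]
  simp only [h2]
  have hxC : Integrable (fun x : ℝ => ((x / (1 + x ^ 2) : ℝ) : ℂ)) ν := hx.ofReal
  rw [integral_add hxC hk, integral_complex_ofReal]
  push_cast
  ring

lemma norm_negLaplace_le {f g : ℝ → ℂ} (hg : Continuous g) {M : ℝ}
    (hM : ∀ u, ‖g u‖ ≤ (1 + |u|) ^ 3 * M) (hfg : ∀ u, ‖f u‖ ≤ ‖g u‖) {t : ℝ} (ht : 0 < t) :
    ‖negLaplace f t‖ ≤ ∫ u in Ioi (0 : ℝ), ‖g (-u)‖ * Real.exp (-(t * u)) := by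
  have hi := (integrableOn_negLaplace hg hM ht).norm
  simp only [norm_mul, Complex.norm_real, Real.norm_eq_abs, Real.abs_exp] at hi
  refine norm_integral_le_of_norm_le hi (Eventually.of_forall fun u => ?_)
  rw [norm_mul, Complex.norm_real, Real.norm_eq_abs, Real.abs_exp]
  exact mul_le_mul_of_nonneg_right (hfg _) (Real.exp_pos _).le

/-- After rescaling `u = s/(j+1)`, the integrand tends to `‖g 0‖e^{-s} = 0`. This limit supplies
tightness. -/
lemma tendsto_mul_integral_norm_mul_exp {g : ℝ → ℂ} (hg : Continuous g) (hg0 : g 0 = 0) {M : ℝ}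
    (hM : ∀ u, ‖g u‖ ≤ (1 + |u|) ^ 3 * M) :
    Tendsto (fun j : ℕ => ((j + 1 : ℕ) : ℝ) *
      ∫ u in Ioi (0 : ℝ), ‖g (-u)‖ * Real.exp (-(((j + 1 : ℕ) : ℝ) * u))) atTop (𝓝 0) := by
  have hM0 : 0 ≤ M := by simpa using (norm_nonneg _).trans (hM 0)
  have h1 : ∀ j : ℕ, ((j + 1 : ℕ) : ℝ) *
      ∫ u in Ioi (0 : ℝ), ‖g (-u)‖ * Real.exp (-(((j + 1 : ℕ) : ℝ) * u)) =
      ∫ s in Ioi (0 : ℝ), ‖g (-(s / (j + 1 : ℕ)))‖ * Real.exp (-(1 * s)) := by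
    intro j
    have hj : (0 : ℝ) < ((j + 1 : ℕ) : ℝ) := Nat.cast_pos.2 j.succ_pos
    have := integral_comp_mul_left_Ioi
      (fun s => ‖g (-(s / (j + 1 : ℕ)))‖ * Real.exp (-(1 * s))) 0 hj
    simp only [mul_div_cancel_left₀ _ hj.ne', one_mul, mul_zero, smul_eq_mul] at this
    rw [this, mul_inv_cancel_left₀ hj.ne']
    simp only [one_mul]
  simp only [h1]
  rw [show 𝓝 (0 : ℝ) = 𝓝 (∫ _ in Ioi (0 : ℝ), (0 : ℝ)) by simp]
  refine tendsto_integral_of_dominated_convergence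
    (fun s => M * ((1 + s) ^ 3 * Real.exp (-(1 * s))))
    (fun j => Continuous.aestronglyMeasurable (by fun_prop))
    ((integrableOn_one_add_pow_mul_exp one_pos).const_mul M)
    (fun j => (ae_restrict_iff' measurableSet_Ioi).2 (Eventually.of_forall fun s hs => ?_))
    (Eventually.of_forall fun s => ?_)
  · have hs' : (0 : ℝ) < s := hs
    have hj : (1 : ℝ) ≤ ((j + 1 : ℕ) : ℝ) := Nat.one_le_cast.2 j.succ_pos
    rw [Real.norm_of_nonneg (by positivity)]
    have h3 := hM (-(s / (j + 1 : ℕ)))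
    rw [abs_neg, abs_of_nonneg (by positivity)] at h3
    have h4 : s / (j + 1 : ℕ) ≤ s := div_le_self hs'.le hj
    calc _ ≤ (1 + s / (j + 1 : ℕ)) ^ 3 * M * Real.exp (-(1 * s)) := by gcongr
      _ ≤ (1 + s) ^ 3 * M * Real.exp (-(1 * s)) := by gcongr
      _ = _ := by ring
  · have h5 : Tendsto (fun j : ℕ => -(s / ((j + 1 : ℕ) : ℝ))) atTop (𝓝 0) := by
      simpa using ((tendsto_const_div_atTop_nhds_zero_nat s).comp (tendsto_add_atTop_nat 1)).neg
    have h6 := ((hg.tendsto 0).comp h5).norm.mul_const (Real.exp (-(1 * s)))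
    simpa [hg0, Function.comp_def] using h6

/-- The transform of an infinitely divisible law is free-infinitely divisible. -/
lemma IsLevyExponent.mem_freeID {ψ : ℝ → ℂ} (h : IsLevyExponent ψ) {M : ℝ}
    (hM : ∀ u, ‖ψ u‖ ≤ (1 + |u|) ^ 3 * M) {V : ℝ → ℂ}
    (hV : ∀ t : ℝ, 0 < t → V t = Complex.I * (t : ℂ) ^ 2 * negLaplace ψ t) : V ∈ FreeID := by
  choose ν hν hc using h.root
  set q : ℕ → ℝ → ℂ := fun n u => ((n + 1 : ℕ) : ℂ) * (charFun (ν n) u - 1) with hq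
  set a : ℕ → ℝ := fun n => ((n + 1 : ℕ) : ℝ) * ∫ x, x / (1 + x ^ 2) ∂(ν n) with ha
  -- `B t` bounds `‖V_n(it)‖/t` for all approximants at once, because `‖q n u‖ ≤ ‖ψ u‖`. It controls
  -- the total mass at `t = 1` and the tails as `t → ∞`.
  set B : ℝ → ℝ := fun t => t * ∫ u in Ioi (0 : ℝ), ‖ψ (-u)‖ * Real.exp (-(t * u)) with hB
  set m : ℕ → FiniteMeasure ℝ := fun n => ⟨scaledMeasure (n + 1) (ν n), inferInstance⟩ with hm
  have hqc : ∀ n, Continuous (q n) := fun n =>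
    continuous_const.mul (continuous_charFun.sub continuous_const)
  have hqψ : ∀ n u, ‖q n u‖ ≤ ‖ψ u‖ := by
    intro n u
    have hN : (0 : ℝ) < ((n + 1 : ℕ) : ℝ) := Nat.cast_pos.2 n.succ_pos
    simp only [hq]
    rw [hc, norm_mul, Complex.norm_natCast]
    have h1 : (ψ u / (n + 1 : ℕ)).re ≤ 0 := by
      rw [Complex.div_natCast_re]
      exact div_nonpos_of_nonpos_of_nonneg (h.re_nonpos u) hN.le
    have h2 := norm_exp_sub_one_le_of_re_nonpos h1
    rw [norm_div, Complex.norm_natCast, le_div_iff₀ hN] at h2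
    linarith
  have hW : ∀ (n : ℕ) (t : ℝ), 0 < t → Complex.I * (t : ℂ) ^ 2 * negLaplace (q n) t =
      (a n : ℂ) + ∫ x, freeKernel t x ∂(m n : Measure ℝ) :=
    fun n t ht => negLaplace_eq_freeKernel (ν n) (n + 1) ht
  have hWB : ∀ (n : ℕ) (t : ℝ), 0 < t → ‖(a n : ℂ) + ∫ x, freeKernel t x ∂(m n : Measure ℝ)‖ / t ≤ B t := by
    intro n t ht
    rw [← hW n t ht, norm_mul, norm_mul, Complex.norm_I, one_mul, norm_pow, Complex.norm_real,
      Real.norm_of_nonneg ht.le, div_le_iff₀ ht]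
    have := mul_le_mul_of_nonneg_left (norm_negLaplace_le h.continuous hM (hqψ n) ht)
      (sq_nonneg t)
    simp only [hB]
    linarith
  have hlim : ∀ t : ℝ, 0 < t → Tendsto (fun n => (a n : ℂ) + ∫ x, freeKernel t x ∂(m n : Measure ℝ))
      atTop (𝓝 (V t)) := by
    intro t ht
    simp only [← hW _ t ht]
    rw [hV t ht]
    refine Tendsto.const_mul _ ?_
    have hi := (integrableOn_negLaplace h.continuous hM ht).norm
    refine tendsto_integral_of_dominated_convergence
      (fun u => ‖ψ (-u) * (Real.exp (-(t * u)) : ℂ)‖) (fun n => ?_) hi (fun n => ?_) ?_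
    · have := hqc n
      exact Continuous.aestronglyMeasurable (by fun_prop)
    · exact Eventually.of_forall fun u => (norm_mul_le _ _).trans (by
        rw [norm_mul (ψ (-u))]
        exact mul_le_mul_of_nonneg_right (hqψ n (-u)) (norm_nonneg (Real.exp (-(t * u)) : ℂ)))
    · refine Eventually.of_forall fun u => Tendsto.mul_const _ ?_
      simp only [hq, hc]
      exact tendsto_mul_exp_div_sub_one _
  have htail : ∀ n (j : ℕ), (m n : Measure ℝ).real {x | ((j + 1 : ℕ) : ℝ) ≤ |x|}
      ≤ 2 * B ((j + 1 : ℕ) : ℝ) := by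
    intro n j
    have hj : (1 : ℝ) ≤ ((j + 1 : ℕ) : ℝ) := Nat.one_le_cast.2 j.succ_pos
    have h1 := measureReal_le_of_freeKernel hj (a n) (m n : Measure ℝ)
    have h2 := hWB n _ (zero_lt_one.trans_le hj)
    linarith
  have hone : ∀ n, ∫ x, freeKernel 1 x ∂(m n : Measure ℝ)
      = -((m n : Measure ℝ).real univ : ℂ) * Complex.I := by
    intro n
    simp [freeKernel_one]
  have hmass : ∀ n, (m n : Measure ℝ).real univ ≤ B 1 := by
    intro n
    have h1 := hWB n 1 one_pos
    have h2 := (neg_le_abs _).trans (Complex.abs_im_le_norm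
      ((a n : ℂ) + ∫ x, freeKernel 1 x ∂(m n : Measure ℝ)))
    rw [div_one] at h1
    refine le_trans ?_ (h2.trans h1)
    rw [hone]
    simp
  have hcompact := isCompact_setOfPred_finiteMeasure_mass_le_compl_isCompact_le (E := ℝ)
    (u := fun j : ℕ => (2 * B ((j + 1 : ℕ) : ℝ)).toNNReal)
    (K := fun j : ℕ => Icc (-((j + 1 : ℕ) : ℝ)) ((j + 1 : ℕ) : ℝ)) (B 1).toNNReal
    (by
      have h1 := (tendsto_mul_integral_norm_mul_exp h.continuous h.zero hM).const_mul 2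
      rw [mul_zero] at h1
      simpa [hB, Function.comp_def] using (continuous_real_toNNReal.tendsto 0).comp h1)
    (fun j => isCompact_Icc) (Or.inl inferInstance)
  have hmem : ∀ n, m n ∈ {μ : FiniteMeasure ℝ | μ.mass ≤ (B 1).toNNReal ∧
      ∀ j : ℕ, μ (Icc (-((j + 1 : ℕ) : ℝ)) ((j + 1 : ℕ) : ℝ))ᶜ
        ≤ (2 * B ((j + 1 : ℕ) : ℝ)).toNNReal} := by
    intro n
    refine ⟨?_, fun j => ?_⟩
    · exact NNReal.le_toNNReal_of_coe_le (hmass n)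
    · refine NNReal.le_toNNReal_of_coe_le (le_trans ?_ (htail n j))
      refine measureReal_mono (μ := (m n : Measure ℝ)) fun x hx => ?_
      by_contra hcon
      exact hx (abs_le.1 (not_le.1 hcon).le)
  obtain ⟨m₀, -, hm₀⟩ := hcompact.exists_mapClusterPt (f := atTop) (u := m)
    (tendsto_principal.2 (Eventually.of_forall hmem))
  -- Convergence along an ultrafilter suffices, since the transforms converge along the whole
  -- sequence.
  obtain ⟨F, hF, hFm⟩ := mapClusterPt_iff_ultrafilter.1 hm₀
  have hker : ∀ t, 0 < t → Tendsto (fun n => ∫ x, freeKernel t x ∂(m n : Measure ℝ)) F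
      (𝓝 (∫ x, freeKernel t x ∂(m₀ : Measure ℝ))) := by
    intro t ht
    exact (FiniteMeasure.tendsto_iff_forall_integral_rclike_tendsto ℂ).1 hFm
      (BoundedContinuousFunction.ofNormedAddCommGroup (freeKernel t) (continuous_freeKernel ht) _
        (norm_freeKernel_le ht))
  -- At `t = 1` the kernel is the constant `-i`, so `a n` is exactly the real part of the
  -- approximating transform.
  have ha_lim : Tendsto (fun n => (a n : ℂ)) F (𝓝 ((V 1).re : ℂ)) := by
    have h1 := (Complex.continuous_re.tendsto _).comp ((hlim 1 one_pos).mono_left hF)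
    refine (Complex.continuous_ofReal.tendsto _).comp (h1.congr fun n => ?_)
    simp only [Function.comp_apply]
    rw [hone]
    simp
  refine ⟨(V 1).re, m₀, inferInstance, fun t ht => ?_⟩
  exact tendsto_nhds_unique ((hlim t ht).mono_left hF) (ha_lim.add (hker t ht))

/-! ### Lowering the class by one. -/

/-- Every element of `(L_k, ⊞)` is the transform of the `k`-fold iterated exponent of a Lévy
process with `Y(1)` in `ID_{log^{k+1}}`. -/
lemma exists_exponent_of_mem_freeUrbanik {k : ℕ} {V : ℝ → ℂ} (hV : V ∈ FreeUrbanik k) :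
    ∃ (ψ : ℝ → ℂ) (w : ℝ → ℝ), IsLevyExponent ψ ∧ HasDecay k ψ w ∧
      (∀ t : ℝ, 0 < t → V t = Complex.I * (t : ℂ) ^ 2 * negLaplace (iteratedExponent ψ k) t) ∧
      ∀ j ≤ k, ∃ ν ∈ UrbanikClass j, ∀ u, charFun ν u = Complex.exp (iteratedExponent ψ j u) := by
  obtain ⟨ν, ⟨μ, hμ, Ω, mΩ, P, Y, Z, hP, hY, hY1, hZ, hZν⟩, χ, hχc, hχ0, hχ, hVχ⟩ := hV
  have := hμ.1.1
  obtain ⟨ψ, hψc, hψ0, hψ⟩ := hY.exists_exponent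
  have hexp : IsLevyExponent ψ := ⟨hψc, hψ0, fun n => ⟨P.map (Y (1 / (n + 1 : ℕ))),
    Measure.isProbabilityMeasure_map (hY.measurable _).aemeasurable, fun u => by
      rw [hψ]
      congr 1
      push_cast
      ring⟩⟩
  have hμψ : ∀ u, charFun μ u = Complex.exp (ψ u) := by
    intro u
    rw [← hY1.map_eq, hψ]
    simp
  obtain ⟨C, -, hC⟩ := hexp.exists_norm_le_decayWeight hμψ
  have hd : HasDecay k ψ (fun t => C * decayWeight μ t) := ⟨hψc, hψ0, fun t u ht => by
      have := hC t u ht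
      linarith, fun j hj => by
      refine ((integrableOn_decayWeight_mul_pow hμ hj).const_mul (C / j !)).congr
        (Eventually.of_forall fun t => ?_)
      simp only
      ring⟩
  -- The logarithm in the definition of the transform is given independently of `Y`; uniqueness of
  -- continuous logarithms identifies it.
  have hχψ : χ = iteratedExponent ψ k := by
    refine eq_of_exp_comp_eq hχc (hd.continuous_iteratedExponent le_rfl)
      (by rw [hχ0, hd.iteratedExponent_zero]) fun u => ?_
    rw [← hχ, ← hZν.map_eq]
    exact hY.charFun_of_tendstoInMeasure hd hψ hZν.aemeasurable hZ u
  refine ⟨ψ, _, hexp, hd, fun t ht => ?_, fun j hj => ?_⟩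
  · rw [(hVχ t ht).2, hχψ, negLaplace]
  -- The same process is integrated against the slower-growing clock `r_j`; its log moment of order
  -- `k+1` also covers order `j+1`.
  · obtain ⟨Z', hZ'm, hZ'⟩ := hY.exists_tendstoInMeasure (hd.mono hj) hψ
    exact ⟨P.map Z', ⟨μ, IDLog_anti hj hμ, Ω, mΩ, P, Y, Z', hP, hY, hY1, hZ',
      ⟨hZ'm.aemeasurable, rfl⟩⟩,
      hY.charFun_of_tendstoInMeasure (hd.mono hj) hψ hZ'm.aemeasurable hZ'⟩

/-- For `k = 0` the exponent left after `D` is that of `Y(1)`, so free infinite divisibility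
applies; otherwise it belongs to the integral of the same process one level down. -/
lemma differentiableOn_and_opD_mem (k : ℕ) {V : ℝ → ℂ} (hV : V ∈ FreeUrbanik k) :
    DifferentiableOn ℝ V (Ioi 0) ∧ opD V ∈ FreeUrbanikPred k := by
  obtain ⟨ψ, w, hexp, hd, hVψ, hν⟩ := exists_exponent_of_mem_freeUrbanik hV
  cases k with
  | zero =>
    have key := fun {t : ℝ} => hasDerivAt_and_opD_eq (t := t) hVψ hd.hasDerivAt_logLaplace_zero
    exact ⟨fun t ht => (key ht).1.differentiableWithinAt,
      hexp.mem_freeID hd.norm_le fun t ht => (key ht).2⟩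
  | succ k =>
    have key := fun {t : ℝ} =>
      hasDerivAt_and_opD_eq (t := t) hVψ (hd.hasDerivAt_logLaplace_succ le_rfl)
    obtain ⟨ν, hνL, hνc⟩ := hν k k.le_succ
    have hcont := hd.continuous_iteratedExponent k.le_succ
    exact ⟨fun t ht => (key ht).1.differentiableWithinAt, ν, hνL, iteratedExponent ψ k, hcont,
      hd.iteratedExponent_zero k, hνc, fun t ht => ⟨integrableOn_negLaplace hcont
        (hd.norm_iteratedExponent_le k.le_succ) ht, (key ht).2⟩⟩

lemma iterate_opD_mem (k : ℕ) : ∀ V ∈ FreeUrbanik k,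
    (∀ j : ℕ, j ≤ k → DifferentiableOn ℝ (opD^[j] V) (Ioi 0)) ∧ opD^[k + 1] V ∈ FreeID := by
  induction k with
  | zero =>
    intro V hV
    obtain ⟨h1, h2⟩ := differentiableOn_and_opD_mem 0 hV
    refine ⟨fun j hj => ?_, h2⟩
    obtain rfl : j = 0 := by omega
    exact h1
  | succ k ih =>
    intro V hV
    obtain ⟨h1, h2⟩ := differentiableOn_and_opD_mem (k + 1) hV
    obtain ⟨h3, h4⟩ := ih (opD V) h2
    refine ⟨fun j hj => ?_, h4⟩
    cases j with
    | zero => exact h1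
    | succ j => exact h3 j (by omega)

theorem corollary3 (k : ℕ) :
    (∀ V ∈ FreeUrbanik k,
      DifferentiableOn ℝ V (Set.Ioi 0) ∧ opD V ∈ FreeUrbanikPred k) ∧
    (∀ V ∈ FreeUrbanik k,
      (∀ j : ℕ, j ≤ k → DifferentiableOn ℝ (opD^[j] V) (Set.Ioi 0)) ∧
      opD^[k + 1] V ∈ FreeID) := by
  exact ⟨fun _ hV => differentiableOn_and_opD_mem k hV, iterate_opD_mem k⟩
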